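/- For complex $a,q$ with $|q|<1$ put $(a;q)_n=\prod_{j=0}^{n-1}(1-aq^j)$ for $n\ge 0$, $(a;q)_\infty=\prod_{j=0}^{\infty}(1-aq^j)$ and $(a_1,\dots,a_r;q)_\infty=(a_1;q)_\infty\cdots(a_r;q)_\infty$, and let $1/(q;q)_n=0$ for negative integers $n$. Theorem. Let $k$ be a positive integer, $\kappa=2k$, and $N_j=n_j+n_{j+1}+\cdots+n_{k-1}$. Let $a,q\in\mathbb{C}$ with $|q|<1$, $a\neq 0$ and $a\neq q^m$ for every integer $m$. Then \begin{align*} \sum_{n=0}^{\infty} & \frac{(q;q)_{2n}\, q^n}{(a;q)_{n+1}(q/a;q)_n} \sum_{n_1,\dots,n_{k-1}=0}^{\infty} \frac{q^{N_1^2+\cdots+N_{k-1}^2+N_1+\cdots+N_{k-1}}} {(q;q)_{n-N_1}(q;q)_{n_1}\cdots(q;q)_{n_{k-2}}(q^2;q^2)_{n_{k-1}}} \\ &=\sum_{n=0}^{\infty} a^n q^{(\kappa-1)\binom{n+1}{2}} +\sum_{i=1}^{\kappa-1} (-1)^{i+1} a^i q^{\binom{i}{2}} \frac{(q^i,q^{\kappa-i},q^{\kappa};q^{\kappa})_{\infty}}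 {(q,a,q/a;q)_{\infty}} \sum_{n=0}^{\infty} (-1)^n a^{\kappa n}q^{(\kappa-1)(kn+i)n}, \end{align*} where all the infinite sums converge absolutely. For $k=1$ the inner multiple sum on the left is understood as $1/(q^2;q^2)_n$. -/

import Mathlib

namespace PartialTheta

/-- The finite `q`-shifted factorial `(a;q)_n = ∏_{j=0}^{n-1} (1 - a q^j)`, for `n ≥ 0`. -/
noncomputable def qPoch (a q : ℂ) (n : ℕ) : ℂ :=
  ∏ j ∈ Finset.range n, (1 - a * q ^ j)

/-- The infinite `q`-shifted factorial `(a;q)_∞ = ∏_{j=0}^∞ (1 - a q^j)`. -/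
noncomputable def qPochInf (a q : ℂ) : ℂ :=
  ∏' j : ℕ, (1 - a * q ^ j)

/-- The product defining `(a;q)_∞` converges whenever `|q| < 1`. -/
theorem multipliable_qPochInf (a q : ℂ) (hq : ‖q‖ < 1) :
    Multipliable fun j : ℕ => 1 - a * q ^ j := by
  have h : Summable fun j : ℕ => ‖-(a * q ^ j)‖ := by
    simpa [norm_mul, norm_pow] using
      (summable_geometric_of_lt_one (norm_nonneg q) hq).mul_left ‖a‖
  simpa [sub_eq_add_neg] using multipliable_one_add_of_summable h

/-- The reciprocal `1 / (q;q)_m` for an integer `m`; it vanishes for negative `m`, by the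
convention `(a;q)_m = (a;q)_∞ / (a q^m;q)_∞`. -/
noncomputable def invqPoch (q : ℂ) (m : ℤ) : ℂ :=
  if 0 ≤ m then 1 / qPoch q q m.toNat else 0

/-- The partial sums `N_j = n_j + n_{j+1} + ⋯ + n_d` of a tuple `(n_1, …, n_d)`
(the entry `n_j` is stored at position `j - 1`). -/
def partialSum {d : ℕ} (v : Fin d → ℕ) (j : Fin d) : ℕ :=
  ∑ i ∈ Finset.Ici j, v i

/-- The summand of the inner multiple sum, as a function of `(n_1, …, n_d)`:
`q^{N_1² + ⋯ + N_d² + N_1 + ⋯ + N_d}` divided by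
`(q;q)_{n-N_1} (q;q)_{n_1} ⋯ (q;q)_{n_{d-1}} (q²;q²)_{n_d}`.
For `d = 0` the denominator consists of its last factor only, whose index is then `n_0 = n`. -/
noncomputable def multisumTerm (q : ℂ) (n : ℕ) : (d : ℕ) → (Fin d → ℕ) → ℂ
  | 0, _ => 1 / qPoch (q ^ 2) (q ^ 2) n
  | d + 1, v =>
      q ^ (∑ j, (partialSum v j ^ 2 + partialSum v j)) *
        invqPoch q ((n : ℤ) - (partialSum v 0 : ℤ)) /
        ((∏ j : Fin d, qPoch q q (v j.castSucc)) *
          qPoch (q ^ 2) (q ^ 2) (v (Fin.last d)))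

/-- The summand of the outer sum over `n`, for the parameter `k`; the inner sum runs over all
`(n_1, …, n_{k-1})` with nonnegative entries. -/
noncomputable def lhsTerm (k : ℕ) (a q : ℂ) (n : ℕ) : ℂ :=
  qPoch q q (2 * n) * q ^ n / (qPoch a q (n + 1) * qPoch (q / a) q n) *
    ∑' v : Fin (k - 1) → ℕ, multisumTerm q n (k - 1) v

/-- The coefficient
`(-1)^{i+1} a^i q^{i(i-1)/2} (q^i, q^{κ-i}, q^κ; q^κ)_∞ / (q, a, q/a; q)_∞`. -/
noncomputable def tripleCoeff (κ : ℕ) (a q : ℂ) (i : ℕ) : ℂ :=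
  (-1) ^ (i + 1) * a ^ i * q ^ (i.choose 2) *
    (qPochInf (q ^ i) (q ^ κ) * qPochInf (q ^ (κ - i)) (q ^ κ) * qPochInf (q ^ κ) (q ^ κ)) /
    (qPochInf q q * qPochInf a q * qPochInf (q / a) q)

end PartialTheta

namespace PartialTheta

open Filter Topology

/-! Write `θ(x) = ∑ (-x)^m q^{m(m-1)/2}` over `m ≥ 0`, `T(a) = (q, a, q/a; q)_∞` and `k = d + 1`.
Two ingredients carry the proof. Bailey chain: `1/(q²;q²)_n` is a sum of `(-1)^r q^{r²} (1 -
q^{2r+1})` against `1/((q;q)_{n-r} (q;q)_{n+r+1})`, and each further summation variable multiplies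
the `r`-th weight by `q^{r²+r}` (`hasSum_multisumTerm`). Warnaar's sum (`warnaarSum_eq`): a
`q`-series in `A, B` equals `θ(A) + θ(B) - 1`. Its mixed `q`-difference telescopes to zero, so it
separates into a function of `A` plus one of `B`. The case `AB = q` is Jacobi's triple product.
Inserting the Bailey pair and summing over `n` first, with `A = a q^{L+1}`, `B = q^{L+1}/a`, turns
`T(a)` times the left side into `∑ (-1)^L q^{(d+1)(L²+L)} (θ(A) + θ(B) - 1)`. By quasi-periodicity
and Jacobi, `T(a)` times the first sum on the right is the same series with `θ(a q^{-L})` in place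
of `θ(A)`. In the difference the `θ(B) - 1` cancel; expanding the remaining `θ`s in powers of `a`
and exchanging sums, the coefficient of each power is a triple product to base `q^{2k}`
(`hasSum_thetaProd_mul_sub`). Collecting exponents by residue mod `2k` gives the second sum. -/

lemma qPoch_zero (a q : ℂ) : qPoch a q 0 = 1 := by simp [qPoch]

lemma qPoch_succ (a q : ℂ) (n : ℕ) : qPoch a q (n + 1) = qPoch a q n * (1 - a * q ^ n) :=
  Finset.prod_range_succ _ _

lemma qPoch_add (a q : ℂ) (m n : ℕ) :
    qPoch a q (m + n) = qPoch a q m * qPoch (a * q ^ m) q n := by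
  simp only [qPoch, Finset.prod_range_add, mul_assoc, pow_add]

lemma qPoch_succ' (a q : ℂ) (n : ℕ) : qPoch a q (n + 1) = (1 - a) * qPoch (a * q) q n := by
  rw [add_comm, qPoch_add]; simp [qPoch]

lemma qPoch_zero_left (q : ℂ) (n : ℕ) : qPoch 0 q n = 1 := by simp [qPoch]

lemma qPochInf_zero_left (q : ℂ) : qPochInf 0 q = 1 := by simp [qPochInf]

/-! ### Limits, nonvanishing and uniform bounds for `q`-shifted factorials -/

lemma tendsto_qPoch {q : ℂ} (hq : ‖q‖ < 1) (a : ℂ) :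
    Tendsto (qPoch a q) atTop (𝓝 (qPochInf a q)) :=
  (multipliable_qPochInf a q hq).hasProd.tendsto_prod_nat

lemma qPochInf_eq {q : ℂ} (hq : ‖q‖ < 1) (a : ℂ) (n : ℕ) :
    qPochInf a q = qPoch a q n * qPochInf (a * q ^ n) q := by
  have h1 : Tendsto (fun m => qPoch a q (n + m)) atTop (𝓝 (qPochInf a q)) :=
    (tendsto_qPoch hq a).comp (tendsto_add_atTop_nat n |>.congr fun m => add_comm m n)
  simp only [qPoch_add] at h1
  exact tendsto_nhds_unique h1 ((tendsto_qPoch hq _).const_mul _)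

lemma qPochInf_succ {q : ℂ} (hq : ‖q‖ < 1) (a : ℂ) :
    qPochInf a q = (1 - a) * qPochInf (a * q) q := by
  simpa [qPoch] using qPochInf_eq hq a 1

lemma qPochInf_one {q : ℂ} (hq : ‖q‖ < 1) : qPochInf 1 q = 0 := by
  rw [qPochInf_succ hq]; simp

lemma qPochInf_ne_zero {a q : ℂ} (hq : ‖q‖ < 1) (h : ∀ j : ℕ, a * q ^ j ≠ 1) :
    qPochInf a q ≠ 0 := by
  have := tprod_one_add_ne_zero_of_summable (f := fun j : ℕ => -(a * q ^ j))
    (fun j => by rw [← sub_eq_add_neg, sub_ne_zero]; exact (h j).symm)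
    (by simpa [norm_mul, norm_pow] using
      (summable_geometric_of_lt_one (norm_nonneg q) hq).mul_left ‖a‖)
  simpa [qPochInf, sub_eq_add_neg] using this

lemma qPoch_ne_zero {a q : ℂ} (h : ∀ j : ℕ, a * q ^ j ≠ 1) (n : ℕ) : qPoch a q n ≠ 0 :=
  Finset.prod_ne_zero_iff.2 fun j _ => sub_ne_zero.2 (h j).symm

lemma mul_pow_ne_one {a q : ℂ} (hq : ‖q‖ < 1) (ha : ‖a‖ < 1) (j : ℕ) : a * q ^ j ≠ 1 := by
  intro h
  have h1 : ‖a * q ^ j‖ = 1 := by rw [h, norm_one]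
  rw [norm_mul, norm_pow] at h1
  have h2 : ‖q‖ ^ j ≤ 1 := pow_le_one₀ (norm_nonneg _) hq.le
  nlinarith [norm_nonneg a]

lemma qPoch_self_ne_zero {q : ℂ} (hq : ‖q‖ < 1) (n : ℕ) : qPoch q q n ≠ 0 :=
  qPoch_ne_zero (mul_pow_ne_one hq hq) n

lemma norm_qPoch_sub_one_le {q : ℂ} (hq : ‖q‖ < 1) (a : ℂ) (n : ℕ) :
    ‖qPoch a q n - 1‖ ≤ Real.exp (‖a‖ / (1 - ‖q‖)) - 1 := by
  have h := Finset.norm_prod_one_add_sub_one_le (Finset.range n) (fun j => -(a * q ^ j))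
  simp only [← sub_eq_add_neg] at h
  refine h.trans (sub_le_sub_right (Real.exp_le_exp.2 ?_) _)
  simp only [norm_neg, norm_mul, norm_pow, ← Finset.mul_sum, div_eq_mul_inv]
  refine mul_le_mul_of_nonneg_left ?_ (norm_nonneg a)
  rw [← tsum_geometric_of_lt_one (norm_nonneg q) hq]
  exact (summable_geometric_of_lt_one (norm_nonneg q) hq).sum_le_tsum _
    fun _ _ => by positivity

lemma norm_qPochInf_sub_one_le {q : ℂ} (hq : ‖q‖ < 1) (a : ℂ) :
    ‖qPochInf a q - 1‖ ≤ Real.exp (‖a‖ / (1 - ‖q‖)) - 1 :=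
  le_of_tendsto ((tendsto_qPoch hq a).sub_const 1).norm
    (Eventually.of_forall (norm_qPoch_sub_one_le hq a))

lemma exp_div_mono {q : ℂ} (hq : ‖q‖ < 1) {x y : ℝ} (h : x ≤ y) :
    Real.exp (x / (1 - ‖q‖)) ≤ Real.exp (y / (1 - ‖q‖)) :=
  Real.exp_le_exp.2 (div_le_div_of_nonneg_right h (by linarith))

lemma norm_qPoch_le {q : ℂ} (hq : ‖q‖ < 1) {a : ℂ} {M : ℝ} (ha : ‖a‖ ≤ M) (n : ℕ) :
    ‖qPoch a q n‖ ≤ Real.exp (M / (1 - ‖q‖)) := by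
  have h := norm_qPoch_sub_one_le hq a n
  have h2 : ‖qPoch a q n‖ ≤ ‖qPoch a q n - 1‖ + 1 := by
    simpa using norm_add_le (qPoch a q n - 1) 1
  linarith [exp_div_mono hq ha]

lemma norm_qPochInf_le {q : ℂ} (hq : ‖q‖ < 1) {a : ℂ} {M : ℝ} (ha : ‖a‖ ≤ M) :
    ‖qPochInf a q‖ ≤ Real.exp (M / (1 - ‖q‖)) :=
  le_of_tendsto (tendsto_qPoch hq a).norm (Eventually.of_forall (norm_qPoch_le hq ha))

lemma tendsto_qPochInf_one {q : ℂ} (hq : ‖q‖ < 1) {ι : Type*} {l : Filter ι} {f : ι → ℂ}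
    (hf : Tendsto f l (𝓝 0)) : Tendsto (fun i => qPochInf (f i) q) l (𝓝 1) := by
  rw [tendsto_iff_norm_sub_tendsto_zero]
  refine squeeze_zero (fun _ => norm_nonneg _) (fun i => norm_qPochInf_sub_one_le hq (f i)) ?_
  have h : Tendsto (fun i => Real.exp (‖f i‖ / (1 - ‖q‖)) - 1) l
      (𝓝 (Real.exp (‖(0 : ℂ)‖ / (1 - ‖q‖)) - 1)) :=
    ((Real.continuous_exp.tendsto _).comp (hf.norm.div_const _)).sub_const 1
  simpa using h

/-- The limit `(a;q)_∞` is nonzero, so the reciprocals converge and are therefore bounded. -/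
lemma exists_le_norm_qPoch {a q : ℂ} (hq : ‖q‖ < 1) (h : ∀ j : ℕ, a * q ^ j ≠ 1) :
    ∃ δ : ℝ, 0 < δ ∧ ∀ n, δ ≤ ‖qPoch a q n‖ := by
  obtain ⟨C, hC⟩ := (((tendsto_qPoch hq a).inv₀ (qPochInf_ne_zero hq h)).norm).bddAbove_range
  have hC' : ∀ n, ‖(qPoch a q n)⁻¹‖ ≤ C := fun n => hC ⟨n, rfl⟩
  have hpos : ∀ n, 0 < ‖qPoch a q n‖ := fun n => norm_pos_iff.2 (qPoch_ne_zero h n)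
  have hC0 : 0 < C := lt_of_lt_of_le (by rw [norm_inv]; exact inv_pos.2 (hpos 0)) (hC' 0)
  refine ⟨C⁻¹, inv_pos.2 hC0, fun n => ?_⟩
  have := hC' n
  rw [norm_inv] at this
  exact inv_le_of_inv_le₀ (hpos n) this

/-- A lower bound for `(c;q)_n` that is uniform in `|c| ≤ |q|`. -/
lemma exists_le_norm_qPoch_of_norm_le {q : ℂ} (hq : ‖q‖ < 1) :
    ∃ δ : ℝ, 0 < δ ∧ ∀ c : ℂ, ‖c‖ ≤ ‖q‖ → ∀ n, δ ≤ ‖qPoch c q n‖ := by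
  -- Factor by factor, `|1 - c q^j| ≥ 1 - |q|^{j+1}`, so the real product with base `‖q‖` is a lower
  -- bound for all admissible `c`.
  have hn : ‖((‖q‖ : ℝ) : ℂ)‖ < 1 := by simpa using hq
  obtain ⟨δ, hδ, h⟩ := exists_le_norm_qPoch hn (mul_pow_ne_one hn hn)
  refine ⟨δ, hδ, fun c hc n => (h n).trans ?_⟩
  simp only [qPoch, norm_prod]
  refine Finset.prod_le_prod (fun _ _ => norm_nonneg _) fun j _ => ?_
  have h1 : ‖q‖ * ‖q‖ ^ j ≤ 1 := mul_le_one₀ hq.le (by positivity)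
    (pow_le_one₀ (norm_nonneg _) hq.le)
  have h2 : ‖(1 : ℂ) - ((‖q‖ : ℝ) : ℂ) * ((‖q‖ : ℝ) : ℂ) ^ j‖ = 1 - ‖q‖ * ‖q‖ ^ j := by
    rw [← Complex.ofReal_pow, ← Complex.ofReal_mul, ← Complex.ofReal_one, ← Complex.ofReal_sub,
      Complex.norm_real, Real.norm_of_nonneg (by linarith)]
  have h3 := norm_sub_norm_le (1 : ℂ) (c * q ^ j)
  rw [norm_mul, norm_pow, norm_one] at h3
  rw [h2]
  have h4 : ‖c‖ * ‖q‖ ^ j ≤ ‖q‖ * ‖q‖ ^ j := by gcongr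
  linarith

/-! ### Partial theta functions, Warnaar's sum and the triple product -/

lemma summable_pow_mul_pow_choose {q : ℂ} (hq : ‖q‖ < 1) (x : ℂ) :
    Summable fun n : ℕ => x ^ n * q ^ n.choose 2 := by
  refine summable_of_ratio_norm_eventually_le (r := 1 / 2) (by norm_num) ?_
  have h : Tendsto (fun n : ℕ => ‖x * q ^ n‖) atTop (𝓝 0) := by
    simpa using ((tendsto_pow_atTop_nhds_zero_of_norm_lt_one hq).const_mul x).norm
  filter_upwards [h.eventually_le_const (show (0 : ℝ) < 1 / 2 by norm_num)] with n hn
  have e : x ^ (n + 1) * q ^ (n + 1).choose 2 = (x * q ^ n) * (x ^ n * q ^ n.choose 2) := by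
    rw [Nat.choose_succ_succ' n 1, Nat.choose_one_right]; ring
  rw [e, norm_mul]
  gcongr

/-- The partial theta function `∑ (-1)^m x^m q^{m(m-1)/2}` over `m ≥ 0`. -/
noncomputable def partialTheta (x q : ℂ) : ℂ :=
  ∑' m : ℕ, (-x) ^ m * q ^ m.choose 2

/-- The summand `q^n (q^{n+1}, A q^n, B q^n; q)_∞ (AB/q;q)_{2n} / (AB;q)_n`. -/
noncomputable def warnaarTerm (A B q : ℂ) (n : ℕ) : ℂ :=
  q ^ n * qPochInf (q * q ^ n) q * qPochInf (A * q ^ n) q * qPochInf (B * q ^ n) q *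
    (qPoch (A * B / q) q (2 * n) / qPoch (A * B) q n)

/-- The telescoping certificate for the second difference of `warnaarTerm`. -/
noncomputable def warnaarCert (A B q : ℂ) (n : ℕ) : ℂ :=
  qPochInf (q ^ n) q * qPochInf (A * q ^ n) q * qPochInf (B * q ^ n) q *
    (qPoch (A * B) q (2 * n) / qPoch (A * B) q n) *
    (A * B * q ^ n * (1 - q + q ^ n * (1 - A * B)) /
      ((1 - A * B * q ^ n) * (q - A * B * (q ^ n) ^ 2)))

lemma warnaarTerm_comm (A B q : ℂ) (n : ℕ) : warnaarTerm A B q n = warnaarTerm B A q n := by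
  simp only [warnaarTerm, mul_comm A B]; ring

lemma mul_pow_ne_one' {c q : ℂ} (hq : ‖q‖ < 1) (hc : ‖c‖ ≤ ‖q‖) (j : ℕ) : c * q ^ j ≠ 1 :=
  mul_pow_ne_one hq (hc.trans_lt hq) j

/-- The rational function identity behind `warnaarTerm_diff_succ`. -/
lemma warnaarCert_rational {A B q x d1 d2 d3 d4 : ℂ} (hq0 : q ≠ 0)
    (N1 : d1 ≠ 0) (N2 : d2 ≠ 0) (N3 : d3 ≠ 0) (N4 : d4 ≠ 0)
    (h1 : d1 = 1 - A * B * x) (h2 : d2 = 1 - A * B * (x * q)) (h3 : d3 = q - A * B * x ^ 2)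
    (h4 : d4 = 1 - A * B * x ^ 2 * q) :
    (1 - A * x) * (1 - B * x) * (q - A * B) / d3
      - (2 - (A + B) * x) * (1 - A * B) / d1
      + (1 - A * B * x ^ 2) * (1 - A * B * q) / (d1 * d2)
      = (1 - A * B * x ^ 2) * d4 / d1 *
          (A * B * q * (1 - q + x * q * (1 - A * B)) / (d2 * (q * d4)))
        - (1 - x) * (1 - A * x) * (1 - B * x) *
          (A * B * (1 - q + x * (1 - A * B)) / (d1 * d3)) := by
  field_simp
  subst h1 h2 h3 h4
  ring

/-- After division by a common product of `q`-factorials, only a rational identity in `A`, `B`, `q`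
and `x = q^{n+1}` remains. -/
lemma warnaarTerm_diff_succ {A B q : ℂ} (hq0 : q ≠ 0) (hq : ‖q‖ < 1) (hc : ‖A * B‖ ≤ ‖q‖)
    (n : ℕ) :
    warnaarTerm A B q (n + 1) - warnaarTerm (A * q) B q (n + 1)
      - warnaarTerm A (B * q) q (n + 1) + warnaarTerm (A * q) (B * q) q (n + 1)
      = warnaarCert A B q (n + 2) - warnaarCert A B q (n + 1) := by
  set c := A * B with hcdef
  set x := q ^ (n + 1) with hx
  have hx2 : q ^ (n + 2) = x * q := pow_succ _ _
  have e1 : A * q * q ^ (n + 1) = A * (x * q) := by rw [hx]; ring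
  have e2 : B * q * q ^ (n + 1) = B * (x * q) := by rw [hx]; ring
  have P1 : qPochInf (A * x) q = (1 - A * x) * qPochInf (A * (x * q)) q := by
    rw [qPochInf_succ hq, mul_assoc]
  have P2 : qPochInf (B * x) q = (1 - B * x) * qPochInf (B * (x * q)) q := by
    rw [qPochInf_succ hq, mul_assoc]
  have P3 : qPochInf x q = (1 - x) * qPochInf (x * q) q := qPochInf_succ hq x
  have hne := mul_pow_ne_one' hq hc
  have N0 : qPoch c q (n + 1) ≠ 0 := qPoch_ne_zero hne _
  have N1 : 1 - c * x ≠ 0 := sub_ne_zero.2 (hne (n + 1)).symm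
  have N2 : 1 - c * (x * q) ≠ 0 := by
    have := hne (n + 2); rw [hx2] at this; exact sub_ne_zero.2 this.symm
  have N3 : q - c * x ^ 2 ≠ 0 := by
    have h : c * x ^ 2 = q * (c * q ^ (2 * n + 1)) := by rw [hx]; ring
    rw [h, show q - q * (c * q ^ (2 * n + 1)) = q * (1 - c * q ^ (2 * n + 1)) by ring]
    exact mul_ne_zero hq0 (sub_ne_zero.2 (hne _).symm)
  have N4 : 1 - c * x ^ 2 * q ≠ 0 := by
    have := hne (2 * n + 3)
    rw [show q ^ (2 * n + 3) = x ^ 2 * q by rw [hx]; ring, ← mul_assoc] at this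
    exact sub_ne_zero.2 this.symm
  have N5 : 1 - c ≠ 0 := by
    have := hne 0
    simp only [pow_zero, mul_one] at this
    exact sub_ne_zero.2 this.symm
  have N6 : 1 - c * q ≠ 0 := by
    have := hne 1
    simp only [pow_one] at this
    exact sub_ne_zero.2 this.symm
  have C1 : qPoch (c / q) q (2 * (n + 1)) * (q - c * x ^ 2)
      = (q - c) * qPoch c q (2 * (n + 1)) := by
    rw [show 2 * (n + 1) = (2 * n + 1) + 1 by ring, qPoch_succ' (c / q), div_mul_cancel₀ _ hq0,
      show c * x ^ 2 = c * q ^ (2 * n + 1) * q by rw [hx]; ring]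
    rw [show 2 * n + 1 + 1 = (2 * n + 1) + 1 by rfl, qPoch_succ c q (2 * n + 1)]
    field_simp
  have C2 : (1 - c) * qPoch (c * q) q (n + 1) = qPoch c q (n + 1) * (1 - c * x) := by
    rw [← qPoch_succ', qPoch_succ]
  have C3 : (1 - c * q) * qPoch (c * q * q) q (n + 1)
      = qPoch (c * q) q (n + 1) * (1 - c * (x * q)) := by
    rw [← qPoch_succ', qPoch_succ, hx]; ring
  have C4 : (1 - c) * qPoch (c * q) q (2 * (n + 1)) = qPoch c q (2 * (n + 1)) * (1 - c * x ^ 2) := by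
    rw [← qPoch_succ', qPoch_succ, hx]; ring
  have C5 : qPoch c q (2 * (n + 2))
      = qPoch c q (2 * (n + 1)) * (1 - c * x ^ 2) * (1 - c * x ^ 2 * q) := by
    rw [show 2 * (n + 2) = 2 * (n + 1) + 1 + 1 by ring, qPoch_succ, qPoch_succ, hx]; ring
  have C6 : qPoch c q (n + 2) = qPoch c q (n + 1) * (1 - c * x) := qPoch_succ _ _ _
  have D1 : qPoch (c / q) q (2 * (n + 1)) = (q - c) * qPoch c q (2 * (n + 1)) / (q - c * x ^ 2) :=
    eq_div_of_mul_eq N3 C1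
  have D2 : qPoch (c * q) q (n + 1) = qPoch c q (n + 1) * (1 - c * x) / (1 - c) :=
    eq_div_of_mul_eq N5 (by rw [← C2, mul_comm])
  have D3 : qPoch (c * q * q) q (n + 1)
      = qPoch c q (n + 1) * (1 - c * x) / (1 - c) * (1 - c * (x * q)) / (1 - c * q) :=
    eq_div_of_mul_eq N6 (by rw [← D2, ← C3, mul_comm])
  have D4 : qPoch (c * q) q (2 * (n + 1)) = qPoch c q (2 * (n + 1)) * (1 - c * x ^ 2) / (1 - c) :=
    eq_div_of_mul_eq N5 (by rw [← C4, mul_comm])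
  have E1 : A * q * B = c * q := by rw [hcdef]; ring
  have E2 : A * (B * q) = c * q := by rw [hcdef]; ring
  have E3 : A * q * (B * q) = c * q * q := by rw [hcdef]; ring
  have E4 : c * q / q = c := mul_div_cancel_right₀ _ hq0
  have E5 : c * q * q / q = c * q := mul_div_cancel_right₀ _ hq0
  simp only [warnaarTerm, warnaarCert]
  rw [E1, E2, E3, E4, E5, ← hcdef, C5, C6, D1, D2, D3, D4, hx2, e1, e2, ← hx, P1, P2, P3,
    mul_comm q x]
  generalize qPoch c q (2 * (n + 1)) = H at *
  generalize qPoch c q (n + 1) = h at *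
  generalize qPochInf (x * q) q = u
  generalize qPochInf (A * (x * q)) q = v
  generalize qPochInf (B * (x * q)) q = w
  have K := warnaarCert_rational hq0 N1 N2 N3 N4 (by rw [hcdef]) (by rw [hcdef]) (by rw [hcdef])
    (by rw [hcdef])
  rw [← hcdef] at K
  rw [show q - c * (x * q) ^ 2 = q * (1 - c * x ^ 2 * q) by ring]
  have K' := congrArg (fun z => x * u * v * w * (H / h) * z) K
  clear_value c
  -- The denominators become atoms, so clearing them never expands the linear factors.
  generalize 1 - c * x = d1 at *
  generalize 1 - c * (x * q) = d2 at *
  generalize q - c * x ^ 2 = d3 at *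
  generalize 1 - c * x ^ 2 * q = d4 at *
  generalize 1 - c = d5 at *
  generalize 1 - c * q = d6 at *
  refine Eq.trans ?_ (K'.trans ?_)
  · field_simp
    ring
  · field_simp

/-- The start of the telescoping is treated apart: at `n = 0` the certificate has the denominator `q
- AB`, which vanishes in the triple product case `AB = q`. -/
lemma warnaarTerm_diff_zero {A B q : ℂ} (hq0 : q ≠ 0) (hq : ‖q‖ < 1) (hc : ‖A * B‖ ≤ ‖q‖) :
    warnaarTerm A B q 0 - warnaarTerm (A * q) B q 0
      - warnaarTerm A (B * q) q 0 + warnaarTerm (A * q) (B * q) q 0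
      = warnaarCert A B q 1 := by
  have hne := mul_pow_ne_one' hq hc
  have N5 : 1 - A * B ≠ 0 := by
    have := hne 0; simp only [pow_zero, mul_one] at this; exact sub_ne_zero.2 this.symm
  have N6 : 1 - A * B * q ≠ 0 := by
    have := hne 1; simp only [pow_one] at this; exact sub_ne_zero.2 this.symm
  have P1 := qPochInf_succ hq A
  have P2 := qPochInf_succ hq B
  simp only [warnaarTerm, warnaarCert, pow_zero, pow_one, mul_one, mul_zero, qPoch_zero]
  rw [P1, P2, show qPoch (A * B) q 2 = (1 - A * B) * (1 - A * B * q) by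
    simp [qPoch, Finset.prod_range_succ], show qPoch (A * B) q 1 = 1 - A * B by simp [qPoch]]
  rw [show q - A * B * q ^ 2 = q * (1 - A * B * q) by ring]
  generalize qPochInf q q = u
  generalize qPochInf (A * q) q = v
  generalize qPochInf (B * q) q = w
  have h : (1 - A * B) * (1 - A * B * q) / (1 - A * B) *
      (A * B * q * (1 - q + q * (1 - A * B)) / ((1 - A * B * q) * (q * (1 - A * B * q))))
      = A * B := by
    generalize hd : 1 - A * B * q = d at *
    generalize he : 1 - A * B = e at *
    field_simp
    rw [← he, ← hd]; ring
  rw [mul_assoc (u * v * w), h]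
  ring

lemma sum_warnaarTerm_diff {A B q : ℂ} (hq0 : q ≠ 0) (hq : ‖q‖ < 1) (hc : ‖A * B‖ ≤ ‖q‖)
    (N : ℕ) :
    ∑ n ∈ Finset.range (N + 1), (warnaarTerm A B q n - warnaarTerm (A * q) B q n
      - warnaarTerm A (B * q) q n + warnaarTerm (A * q) (B * q) q n)
      = warnaarCert A B q (N + 1) := by
  induction N with
  | zero => simpa using warnaarTerm_diff_zero hq0 hq hc
  | succ N ih => rw [Finset.sum_range_succ, ih, warnaarTerm_diff_succ hq0 hq hc]; ring

lemma norm_mul_pow_le {q : ℂ} (hq : ‖q‖ < 1) (a : ℂ) (n : ℕ) : ‖a * q ^ n‖ ≤ ‖a‖ := by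
  rw [norm_mul, norm_pow]
  exact mul_le_of_le_one_right (norm_nonneg _) (pow_le_one₀ (norm_nonneg _) hq.le)

lemma tendsto_mul_pow {q : ℂ} (hq : ‖q‖ < 1) (a : ℂ) :
    Tendsto (fun n : ℕ => a * q ^ n) atTop (𝓝 0) := by
  simpa using (tendsto_pow_atTop_nhds_zero_of_norm_lt_one hq).const_mul a

/-- Uniformity in `A` and `B` supplies the majorant for dominated convergence as `A` or `B` tends to
`0`. -/
lemma exists_norm_warnaarTerm_le {q : ℂ} (hq0 : q ≠ 0) (hq : ‖q‖ < 1) (M : ℝ) :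
    ∃ C : ℝ, ∀ A B : ℂ, ‖A‖ ≤ M → ‖B‖ ≤ M → ‖A * B‖ ≤ ‖q‖ → ∀ n,
      ‖warnaarTerm A B q n‖ ≤ C * ‖q‖ ^ n := by
  obtain ⟨δ, hδ, h⟩ := exists_le_norm_qPoch_of_norm_le hq
  refine ⟨Real.exp (1 / (1 - ‖q‖)) * Real.exp (M / (1 - ‖q‖)) * Real.exp (M / (1 - ‖q‖)) *
    (Real.exp (1 / (1 - ‖q‖)) / δ), fun A B hA hB hc n => ?_⟩
  have h1 : ‖qPochInf (q * q ^ n) q‖ ≤ Real.exp (1 / (1 - ‖q‖)) :=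
    norm_qPochInf_le hq ((norm_mul_pow_le hq q n).trans hq.le)
  have h2 : ‖qPochInf (A * q ^ n) q‖ ≤ Real.exp (M / (1 - ‖q‖)) :=
    norm_qPochInf_le hq ((norm_mul_pow_le hq A n).trans hA)
  have h3 : ‖qPochInf (B * q ^ n) q‖ ≤ Real.exp (M / (1 - ‖q‖)) :=
    norm_qPochInf_le hq ((norm_mul_pow_le hq B n).trans hB)
  have h4 : ‖qPoch (A * B / q) q (2 * n)‖ ≤ Real.exp (1 / (1 - ‖q‖)) := by
    refine norm_qPoch_le hq ?_ _
    rw [norm_div]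
    exact div_le_one_of_le₀ hc (norm_nonneg _)
  have h5 := h (A * B) hc n
  rw [warnaarTerm, norm_mul, norm_mul, norm_mul, norm_mul, norm_div, norm_pow]
  calc _ ≤ ‖q‖ ^ n * Real.exp (1 / (1 - ‖q‖)) * Real.exp (M / (1 - ‖q‖)) *
        Real.exp (M / (1 - ‖q‖)) * (Real.exp (1 / (1 - ‖q‖)) / δ) := by gcongr
    _ = _ := by ring

lemma summable_warnaarTerm {A B q : ℂ} (hq0 : q ≠ 0) (hq : ‖q‖ < 1) (hc : ‖A * B‖ ≤ ‖q‖) :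
    Summable (warnaarTerm A B q) := by
  obtain ⟨C, hC⟩ := exists_norm_warnaarTerm_le hq0 hq (max ‖A‖ ‖B‖)
  exact Summable.of_norm_bounded
    ((summable_geometric_of_lt_one (norm_nonneg q) hq).mul_left C)
    (hC A B (le_max_left _ _) (le_max_right _ _) hc)

/-- The sum of `warnaarTerm`. -/
noncomputable def warnaarSum (A B q : ℂ) : ℂ := ∑' n, warnaarTerm A B q n

lemma warnaarSum_comm (A B q : ℂ) : warnaarSum A B q = warnaarSum B A q :=
  tsum_congr (warnaarTerm_comm A B q)

lemma tendsto_warnaarCert {A B q : ℂ} (hq0 : q ≠ 0) (hq : ‖q‖ < 1) (hc : ‖A * B‖ ≤ ‖q‖) :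
    Tendsto (warnaarCert A B q) atTop (𝓝 0) := by
  have hx := tendsto_pow_atTop_nhds_zero_of_norm_lt_one hq
  have hne : qPochInf (A * B) q ≠ 0 := qPochInf_ne_zero hq (mul_pow_ne_one' hq hc)
  have h2 : Tendsto (fun n => qPoch (A * B) q (2 * n) / qPoch (A * B) q n) atTop
      (𝓝 (qPochInf (A * B) q / qPochInf (A * B) q)) :=
    ((tendsto_qPoch hq _).comp (tendsto_id.const_mul_atTop' two_pos)).div (tendsto_qPoch hq _) hne
  have h3 : Tendsto (fun n => A * B * q ^ n * (1 - q + q ^ n * (1 - A * B)) /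
      ((1 - A * B * q ^ n) * (q - A * B * (q ^ n) ^ 2))) atTop
      (𝓝 (A * B * 0 * (1 - q + 0 * (1 - A * B)) / ((1 - A * B * 0) * (q - A * B * 0 ^ 2)))) := by
    refine Tendsto.div ?_ ?_ (by simpa using hq0)
    · exact (hx.const_mul _).mul ((hx.mul_const _).const_add _)
    · exact ((hx.const_mul _).const_sub _).mul (((hx.pow 2).const_mul _).const_sub _)
  have := (((tendsto_qPochInf_one hq hx).mul (tendsto_qPochInf_one hq (tendsto_mul_pow hq A))).mul
    (tendsto_qPochInf_one hq (tendsto_mul_pow hq B))).mul h2 |>.mul h3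
  simp at this
  exact this

lemma norm_mul_q_le {c q : ℂ} (hq : ‖q‖ < 1) (hc : ‖c‖ ≤ ‖q‖) : ‖c * q‖ ≤ ‖q‖ :=
  (by simpa using norm_mul_pow_le hq c 1 : ‖c * q‖ ≤ ‖c‖).trans hc

lemma warnaarSum_diff {A B q : ℂ} (hq0 : q ≠ 0) (hq : ‖q‖ < 1) (hc : ‖A * B‖ ≤ ‖q‖) :
    warnaarSum A B q - warnaarSum (A * q) B q
      = warnaarSum A (B * q) q - warnaarSum (A * q) (B * q) q := by
  have h1 : ‖A * q * B‖ ≤ ‖q‖ := by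
    rw [mul_right_comm]; exact norm_mul_q_le hq hc
  have h2 : ‖A * (B * q)‖ ≤ ‖q‖ := by rw [← mul_assoc]; exact norm_mul_q_le hq hc
  have h3 : ‖A * q * (B * q)‖ ≤ ‖q‖ := by rw [← mul_assoc]; exact norm_mul_q_le hq h1
  have S := (((summable_warnaarTerm hq0 hq hc).hasSum.sub
    (summable_warnaarTerm hq0 hq h1).hasSum).sub (summable_warnaarTerm hq0 hq h2).hasSum).add
    (summable_warnaarTerm hq0 hq h3).hasSum
  have T := (S.tendsto_sum_nat.comp (tendsto_add_atTop_nat 1)).congr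
    (fun N => sum_warnaarTerm_diff hq0 hq hc N)
  have := tendsto_nhds_unique T ((tendsto_warnaarCert hq0 hq hc).comp (tendsto_add_atTop_nat 1))
  unfold warnaarSum
  linear_combination this

lemma norm_mul_pow_mul_le {A B q : ℂ} (hq : ‖q‖ < 1) (hc : ‖A * B‖ ≤ ‖q‖) (i j : ℕ) :
    ‖A * q ^ i * (B * q ^ j)‖ ≤ ‖q‖ := by
  rw [show A * q ^ i * (B * q ^ j) = A * B * q ^ (i + j) by ring]
  exact (norm_mul_pow_le hq _ _).trans hc

/-- Adding the vanishing unit mixed differences over an `i × j` rectangle leaves only its corners.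
-/
lemma warnaarSum_diff_pow {A B q : ℂ} (hq0 : q ≠ 0) (hq : ‖q‖ < 1) (hc : ‖A * B‖ ≤ ‖q‖)
    (i j : ℕ) :
    warnaarSum A B q - warnaarSum (A * q ^ i) B q
      = warnaarSum A (B * q ^ j) q - warnaarSum (A * q ^ i) (B * q ^ j) q := by
  have step : ∀ i j : ℕ, warnaarSum A (B * q ^ j) q - warnaarSum (A * q ^ i) (B * q ^ j) q
      = warnaarSum A (B * q ^ (j + 1)) q - warnaarSum (A * q ^ i) (B * q ^ (j + 1)) q := by
    intro i j
    induction i with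
    | zero => simp
    | succ i ih =>
      have := warnaarSum_diff hq0 hq (norm_mul_pow_mul_le hq hc i j)
      rw [mul_assoc A, ← pow_succ, mul_assoc B, ← pow_succ] at this
      linear_combination ih + this
  induction j with
  | zero => simp
  | succ j ih => rw [ih, step]

/-- Convergence is assumed for the infinite products, not for `f` and `g`: this covers constant
sequences and sequences tending to `0` using continuity of `(x;q)_∞` at `0` only. -/
lemma tendsto_warnaarSum {q : ℂ} (hq0 : q ≠ 0) (hq : ‖q‖ < 1) {M : ℝ} {f g : ℕ → ℂ} {A B : ℂ}
    (hf : ∀ i, ‖f i‖ ≤ M) (hg : ∀ i, ‖g i‖ ≤ M) (hfg : ∀ i, ‖f i * g i‖ ≤ ‖q‖)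
    (hfg' : Tendsto (fun i => f i * g i) atTop (𝓝 (A * B))) (hc : ‖A * B‖ ≤ ‖q‖)
    (hfA : ∀ n, Tendsto (fun i => qPochInf (f i * q ^ n) q) atTop (𝓝 (qPochInf (A * q ^ n) q)))
    (hgB : ∀ n, Tendsto (fun i => qPochInf (g i * q ^ n) q) atTop (𝓝 (qPochInf (B * q ^ n) q))) :
    Tendsto (fun i => warnaarSum (f i) (g i) q) atTop (𝓝 (warnaarSum A B q)) := by
  obtain ⟨C, hC⟩ := exists_norm_warnaarTerm_le hq0 hq M
  refine tendsto_tsum_of_dominated_convergence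
    ((summable_geometric_of_lt_one (norm_nonneg q) hq).mul_left C) (fun n => ?_)
    (Eventually.of_forall fun i n => hC _ _ (hf i) (hg i) (hfg i) n)
  have hP : ∀ (h : ℕ → ℂ) (c : ℂ), Tendsto h atTop (𝓝 c) → ∀ m,
      Tendsto (fun i => qPoch (h i) q m) atTop (𝓝 (qPoch c q m)) := fun h c hh m =>
    tendsto_finsetProd _ fun j _ => (hh.mul_const _).const_sub _
  exact (((tendsto_const_nhds).mul (hfA n)).mul (hgB n)).mul
    ((hP _ _ (hfg'.div_const q) _).div (hP _ _ hfg' _) (qPoch_ne_zero (mul_pow_ne_one' hq hc) n))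

lemma tendsto_qPochInf_mul_pow_mul {q : ℂ} (hq : ‖q‖ < 1) (A : ℂ) (n : ℕ) :
    Tendsto (fun i : ℕ => qPochInf (A * q ^ i * q ^ n) q) atTop (𝓝 (qPochInf (0 * q ^ n) q)) := by
  rw [zero_mul, qPochInf_zero_left]
  refine tendsto_qPochInf_one hq ?_
  simpa using (tendsto_mul_pow hq A).mul_const (q ^ n)

lemma tendsto_warnaarSum_left {A B q : ℂ} (hq0 : q ≠ 0) (hq : ‖q‖ < 1) (hc : ‖A * B‖ ≤ ‖q‖) :
    Tendsto (fun i : ℕ => warnaarSum (A * q ^ i) B q) atTop (𝓝 (warnaarSum 0 B q)) := by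
  refine tendsto_warnaarSum hq0 hq (M := max ‖A‖ ‖B‖) (f := fun i => A * q ^ i) (g := fun _ => B)
    (fun i => (norm_mul_pow_le hq A i).trans (le_max_left _ _)) (fun _ => le_max_right _ _)
    (fun i => by simpa using norm_mul_pow_mul_le hq hc i 0) ?_ (by simp)
    (tendsto_qPochInf_mul_pow_mul hq A) (fun _ => tendsto_const_nhds)
  exact (tendsto_mul_pow hq A).mul_const B

lemma tendsto_warnaarSum_both {A B q : ℂ} (hq0 : q ≠ 0) (hq : ‖q‖ < 1) (hc : ‖A * B‖ ≤ ‖q‖) :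
    Tendsto (fun i : ℕ => warnaarSum (A * q ^ i) (B * q ^ i) q) atTop (𝓝 (warnaarSum 0 0 q)) := by
  refine tendsto_warnaarSum hq0 hq (M := max ‖A‖ ‖B‖) (f := fun i => A * q ^ i)
    (g := fun i => B * q ^ i)
    (fun i => (norm_mul_pow_le hq A i).trans (le_max_left _ _))
    (fun i => (norm_mul_pow_le hq B i).trans (le_max_right _ _))
    (fun i => norm_mul_pow_mul_le hq hc i i) ?_ (by simp)
    (tendsto_qPochInf_mul_pow_mul hq A) (tendsto_qPochInf_mul_pow_mul hq B)
  exact (tendsto_mul_pow hq A).mul (tendsto_mul_pow hq B)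

lemma warnaarSum_eq_add {A B q : ℂ} (hq0 : q ≠ 0) (hq : ‖q‖ < 1) (hc : ‖A * B‖ ≤ ‖q‖) :
    warnaarSum A B q = warnaarSum A 0 q + warnaarSum B 0 q - warnaarSum 0 0 q := by
  have h1 := tendsto_warnaarSum_left hq0 hq hc
  have h2 : Tendsto (fun i : ℕ => warnaarSum A (B * q ^ i) q) atTop (𝓝 (warnaarSum A 0 q)) := by
    simp only [warnaarSum_comm A]
    exact tendsto_warnaarSum_left hq0 hq (by rwa [mul_comm])
  have h3 := tendsto_warnaarSum_both hq0 hq hc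
  have h4 := (h1.add h2).sub h3
  have h5 : Tendsto (fun _ : ℕ => warnaarSum A B q) atTop (𝓝 _) :=
    h4.congr fun i => by linear_combination -warnaarSum_diff_pow hq0 hq hc i i
  rw [tendsto_nhds_unique tendsto_const_nhds h5, warnaarSum_comm 0 B]
  ring

lemma warnaarTerm_zero_right (A q : ℂ) (n : ℕ) :
    warnaarTerm A 0 q n = q ^ n * qPochInf (q * q ^ n) q * qPochInf (A * q ^ n) q := by
  simp [warnaarTerm, qPochInf_zero_left, qPoch_zero_left]

/-- The sum `W(A,0) + A W(Aq,0)` telescopes with partial sums `(q^n;q)_∞ (A q^n;q)_∞`, which start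
at `(1;q)_∞ (A;q)_∞ = 0` and tend to `1`. -/
lemma warnaarSum_zero_right_rec {q : ℂ} (hq0 : q ≠ 0) (hq : ‖q‖ < 1) (A : ℂ) :
    warnaarSum A 0 q = 1 - A * warnaarSum (A * q) 0 q := by
  have hz : ∀ A : ℂ, ‖A * 0‖ ≤ ‖q‖ := fun A => by simp
  set u : ℕ → ℂ := fun n => qPochInf (q ^ n) q * qPochInf (A * q ^ n) q with hu
  have hx := tendsto_pow_atTop_nhds_zero_of_norm_lt_one hq
  have hu1 : Tendsto u atTop (𝓝 1) := by
    simpa using (tendsto_qPochInf_one hq hx).mul (tendsto_qPochInf_one hq (tendsto_mul_pow hq A))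
  have hs : ∀ N, ∑ n ∈ Finset.range N, (warnaarTerm A 0 q n + A * warnaarTerm (A * q) 0 q n)
      = u N := by
    intro N
    induction N with
    | zero => simp [hu, qPochInf_one hq]
    | succ N ih =>
      rw [Finset.sum_range_succ, ih, warnaarTerm_zero_right, warnaarTerm_zero_right]
      simp only [hu]
      rw [qPochInf_succ hq (q ^ N), qPochInf_succ hq (A * q ^ N), pow_succ, mul_comm q,
        ← mul_assoc A, show A * q * q ^ N = A * q ^ N * q by ring]
      ring_nf
  have S := (summable_warnaarTerm hq0 hq (hz A)).hasSum.add
    ((summable_warnaarTerm hq0 hq (hz (A * q))).hasSum.mul_left A)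
  have := tendsto_nhds_unique (S.tendsto_sum_nat.congr hs) hu1
  unfold warnaarSum
  linear_combination this

lemma warnaarSum_zero_right {q : ℂ} (hq0 : q ≠ 0) (hq : ‖q‖ < 1) (A : ℂ) :
    warnaarSum A 0 q = partialTheta A q := by
  have hs : ∀ N, warnaarSum A 0 q = ∑ m ∈ Finset.range N, (-A) ^ m * q ^ m.choose 2
      + (-A) ^ N * q ^ N.choose 2 * warnaarSum (A * q ^ N) 0 q := by
    intro N
    induction N with
    | zero => simp
    | succ N ih =>
      rw [Finset.sum_range_succ, ih, warnaarSum_zero_right_rec hq0 hq (A * q ^ N),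
        Nat.choose_succ_succ' N 1, Nat.choose_one_right,
        show A * q ^ N * q = A * q ^ (N + 1) by ring]
      ring
  have h1 := (summable_pow_mul_pow_choose hq (-A))
  have h2 := tendsto_warnaarSum_left (A := A) (B := 0) hq0 hq (by simp)
  have h3 := h1.hasSum.tendsto_sum_nat.add (h1.tendsto_atTop_zero.mul h2)
  have h4 : Tendsto (fun _ : ℕ => warnaarSum A 0 q) atTop (𝓝 _) := h3.congr fun N => (hs N).symm
  rw [tendsto_nhds_unique tendsto_const_nhds h4, partialTheta]
  ring

lemma partialTheta_zero_left (q : ℂ) : partialTheta 0 q = 1 := by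
  rw [partialTheta, tsum_eq_single 0 (fun m hm => by simp [hm])]
  simp

/-- Warnaar's sum of two partial theta functions. -/
theorem warnaarSum_eq {A B q : ℂ} (hq0 : q ≠ 0) (hq : ‖q‖ < 1) (hc : ‖A * B‖ ≤ ‖q‖) :
    warnaarSum A B q = partialTheta A q + partialTheta B q - 1 := by
  rw [warnaarSum_eq_add hq0 hq hc, warnaarSum_zero_right hq0 hq, warnaarSum_zero_right hq0 hq,
    warnaarSum_zero_right hq0 hq, partialTheta_zero_left]

/-- The Jacobi triple product identity. -/
theorem jacobi_triple_product {a q : ℂ} (hq0 : q ≠ 0) (hq : ‖q‖ < 1) (ha : a ≠ 0) :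
    qPochInf q q * qPochInf a q * qPochInf (q / a) q
      = partialTheta a q + partialTheta (q / a) q - 1 := by
  have hc : a * (q / a) = q := mul_div_cancel₀ _ ha
  -- Here `AB = q`, so the factor `(AB/q;q)_{2n} = (1;q)_{2n}` kills every term but `n = 0`.
  rw [← warnaarSum_eq hq0 hq (by rw [hc]), warnaarSum, tsum_eq_single 0]
  · simp [warnaarTerm, qPoch_zero]
  · intro n hn
    obtain ⟨m, rfl⟩ := Nat.exists_eq_succ_of_ne_zero hn
    rw [warnaarTerm, hc, div_self hq0,
      show 2 * m.succ = 2 * m + 1 + 1 by rw [Nat.succ_eq_add_one]; ring,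
      qPoch_succ' 1]
    simp

/-! ### The Bailey pair and the Bailey chain -/

lemma one_sub_pow_succ_ne_zero {q : ℂ} (hq : ‖q‖ < 1) (n : ℕ) : 1 - q ^ (n + 1) ≠ 0 := by
  rw [pow_succ']
  exact sub_ne_zero.2 (mul_pow_ne_one hq hq n).symm

lemma qPoch_self_succ (q : ℂ) (n : ℕ) : qPoch q q (n + 1) = qPoch q q n * (1 - q ^ (n + 1)) := by
  rw [qPoch_succ, ← pow_succ']

/-- A form of the `q`-Chu--Vandermonde sum. -/
lemma qVandermonde {q : ℂ} (hq : ‖q‖ < 1) (N s : ℕ) :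
    ∑ p ∈ Finset.range (N + 1),
      q ^ (p ^ 2 + p * s) / (qPoch q q (N - p) * qPoch q q p * qPoch q q (p + s))
      = 1 / (qPoch q q N * qPoch q q (N + s)) := by
  induction N generalizing s with
  | zero => simp [qPoch_zero]
  | succ N ih =>
    have hN := qPoch_self_ne_zero hq
    -- Splitting `1 - q^{N+1} = (1 - q^{N+1-p}) + q^{N+1-p} (1 - q^p)`, the first part lowers
    -- `(q;q)_{N+1-p}` and gives the case `(N, s)`; the second lowers `(q;q)_p` and, after `p ↦ p +
    -- 1`, gives `(N, s + 1)`.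
    have key : ∀ p ∈ Finset.range (N + 1 + 1), (1 - q ^ (N + 1)) *
        (q ^ (p ^ 2 + p * s) / (qPoch q q (N + 1 - p) * qPoch q q p * qPoch q q (p + s)))
        = (1 - q ^ (N + 1 - p)) *
          (q ^ (p ^ 2 + p * s) / (qPoch q q (N + 1 - p) * qPoch q q p * qPoch q q (p + s)))
        + q ^ (N + 1 - p) * (1 - q ^ p) *
          (q ^ (p ^ 2 + p * s) / (qPoch q q (N + 1 - p) * qPoch q q p * qPoch q q (p + s))) := by
      intro p hp
      have h : q ^ (N + 1) = q ^ (N + 1 - p) * q ^ p := by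
        rw [← pow_add, Nat.sub_add_cancel (Nat.lt_succ_iff.1 (Finset.mem_range.1 hp))]
      rw [h]; ring
    have h0 := one_sub_pow_succ_ne_zero hq N
    refine mul_left_cancel₀ h0 ?_
    rw [Finset.mul_sum, Finset.sum_congr rfl key, Finset.sum_add_distrib, Finset.sum_range_succ,
      Finset.sum_range_succ' _ (N + 1)]
    have e1 : ∑ p ∈ Finset.range (N + 1), (1 - q ^ (N + 1 - p)) *
          (q ^ (p ^ 2 + p * s) / (qPoch q q (N + 1 - p) * qPoch q q p * qPoch q q (p + s)))
        = 1 / (qPoch q q N * qPoch q q (N + s)) := by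
      rw [← ih s]
      refine Finset.sum_congr rfl fun p hp => ?_
      rw [show N + 1 - p = (N - p) + 1 by have := Finset.mem_range.1 hp; omega, qPoch_self_succ]
      have := one_sub_pow_succ_ne_zero hq (N - p)
      have := hN (N - p); have := hN p; have := hN (p + s)
      field_simp
    have e2 : ∑ p ∈ Finset.range (N + 1), q ^ (N + 1 - (p + 1)) * (1 - q ^ (p + 1)) *
          (q ^ ((p + 1) ^ 2 + (p + 1) * s) /
            (qPoch q q (N + 1 - (p + 1)) * qPoch q q (p + 1) * qPoch q q (p + 1 + s)))
        = q ^ (N + 1 + s) * (1 / (qPoch q q N * qPoch q q (N + (s + 1)))) := by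
      rw [← ih (s + 1), Finset.mul_sum]
      refine Finset.sum_congr rfl fun p hp => ?_
      have hp' := Finset.mem_range.1 hp
      rw [show N + 1 - (p + 1) = N - p by omega, qPoch_self_succ q p,
        show p + 1 + s = p + (s + 1) by ring]
      have h1 := one_sub_pow_succ_ne_zero hq p
      have := hN (N - p); have := hN p; have := hN (p + (s + 1))
      have h2 : q ^ (N - p) * q ^ ((p + 1) ^ 2 + (p + 1) * s)
          = q ^ (N + 1 + s) * q ^ (p ^ 2 + p * (s + 1)) := by
        rw [← pow_add, ← pow_add]
        congr 1
        obtain ⟨t, rfl⟩ := Nat.exists_eq_add_of_le (Nat.lt_succ_iff.1 hp')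
        rw [Nat.add_sub_cancel_left]; ring
      generalize 1 - q ^ (p + 1) = d at *
      field_simp
      linear_combination h2
    rw [e1, e2]
    simp only [Nat.sub_self, pow_zero, sub_self, zero_mul, mul_zero, add_zero]
    rw [show N + (s + 1) = N + s + 1 by ring, show N + 1 + s = N + s + 1 by ring,
      qPoch_self_succ q N, qPoch_self_succ q (N + s)]
    have h1 := one_sub_pow_succ_ne_zero hq (N + s)
    have := hN N; have := hN (N + s)
    generalize hd : 1 - q ^ (N + s + 1) = d at *
    rw [show q ^ (N + s + 1) = 1 - d by rw [← hd]; ring]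
    generalize 1 - q ^ (N + 1) = e at *
    field_simp
    ring

/-- The entries `1 / ((q;q)_{n-r} (q;q)_{n+r+1})` of the Bailey matrix, `0` for `r > n`. -/
noncomputable def baileyEntry (q : ℂ) (n r : ℕ) : ℂ :=
  if r ≤ n then 1 / (qPoch q q (n - r) * qPoch q q (n + r + 1)) else 0

lemma baileyEntry_add (q : ℂ) (r N : ℕ) :
    baileyEntry q (r + N) r = 1 / (qPoch q q N * qPoch q q (N + 2 * r + 1)) := by
  rw [baileyEntry, if_pos (Nat.le_add_right _ _), Nat.add_sub_cancel_left,
    show r + N + r + 1 = N + 2 * r + 1 by ring]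

lemma baileyEntry_of_lt (q : ℂ) {n r : ℕ} (h : n < r) : baileyEntry q n r = 0 :=
  if_neg (not_le.2 h)

lemma invqPoch_natCast_sub (q : ℂ) {n m : ℕ} (h : m ≤ n) :
    invqPoch q ((n : ℤ) - m) = 1 / qPoch q q (n - m) := by
  rw [← Nat.cast_sub h]
  simp [invqPoch]

lemma invqPoch_of_lt (q : ℂ) {n m : ℕ} (h : n < m) : invqPoch q ((n : ℤ) - m) = 0 :=
  if_neg (by omega)

/-- With `m = r + p` this is `qVandermonde` for `s = 2r + 1`: the limiting Bailey lemma relative to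
`q`. -/
lemma baileyEntry_step {q : ℂ} (hq : ‖q‖ < 1) (n r : ℕ) :
    ∑ m ∈ Finset.range (n + 1), q ^ (m ^ 2 + m) * invqPoch q ((n : ℤ) - m) * baileyEntry q m r
      = q ^ (r ^ 2 + r) * baileyEntry q n r := by
  rcases lt_or_ge n r with h | h
  · rw [baileyEntry_of_lt q h, mul_zero]
    refine Finset.sum_eq_zero fun m hm => ?_
    rw [baileyEntry_of_lt q (by have := Finset.mem_range.1 hm; omega), mul_zero]
  · obtain ⟨N, rfl⟩ := Nat.exists_eq_add_of_le h
    rw [add_assoc, Finset.sum_range_add, Finset.sum_eq_zero, zero_add, baileyEntry_add,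
      add_assoc N, ← qVandermonde hq N (2 * r + 1), Finset.mul_sum]
    · refine Finset.sum_congr rfl fun p hp => ?_
      rw [invqPoch_natCast_sub q (by have := Finset.mem_range.1 hp; omega), baileyEntry_add,
        show r + N - (r + p) = N - p by omega,
        show (r + p) ^ 2 + (r + p) = (r ^ 2 + r) + (p ^ 2 + p * (2 * r + 1)) by ring, pow_add,
        add_assoc p]
      have hN := qPoch_self_ne_zero hq
      have := hN (N - p); have := hN p; have := hN (p + (2 * r + 1))
      field_simp
    · intro m hm
      rw [baileyEntry_of_lt q (Finset.mem_range.1 hm), mul_zero]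

/-- The weights `(-1)^r q^{r² + d (r² + r)} (1 - q^{2r+1})` of the iterated Bailey pair. -/
noncomputable def baileyWeight (q : ℂ) (d r : ℕ) : ℂ :=
  (-1) ^ r * q ^ (r ^ 2 + d * (r ^ 2 + r)) * (1 - q ^ (2 * r + 1))

/-- An indefinite summation behind the recurrence `(1 - q^{2n+2}) S_{n+1} = S_n` for the sums of the
initial Bailey pair. Here `n = M + t` stays fixed while the cut-off `M` grows; at `t = 0` only the
term `r = n + 1` of `S_{n+1}` is missing. -/
lemma sum_baileyWeight_zero_step {q : ℂ} (hq : ‖q‖ < 1) (M t : ℕ) :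
    ∑ r ∈ Finset.range (M + 1), ((1 - q ^ (2 * (M + t) + 2)) *
      (baileyWeight q 0 r * baileyEntry q (M + t + 1) r)
        - baileyWeight q 0 r * baileyEntry q (M + t) r)
      = (-1) ^ M * q ^ (M ^ 2 + M + (M + t) + 1) * (1 - q ^ (2 * M + 2)) /
        (qPoch q q t * qPoch q q (2 * M + t + 2)) := by
  have hN := qPoch_self_ne_zero hq
  induction M generalizing t with
  | zero =>
    have h1 := baileyEntry_add q 0 (t + 1)
    have h2 := baileyEntry_add q 0 t
    simp only [zero_add, mul_zero, add_zero] at h1 h2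
    simp only [zero_add, Finset.sum_range_one, baileyWeight, h1, h2, mul_zero, add_zero, pow_zero,
      zero_mul, one_mul, pow_one, ne_eq, OfNat.ofNat_ne_zero, not_false_eq_true, zero_pow]
    rw [qPoch_self_succ q (t + 1), qPoch_self_succ q t]
    have := one_sub_pow_succ_ne_zero hq t
    have h3 := one_sub_pow_succ_ne_zero hq (t + 1)
    have h4 := hN t
    rw [show t + 1 + 1 = t + 2 by ring] at *
    have e1 : q ^ (2 * t + 2) = (q ^ (t + 1)) ^ 2 := by ring
    have e2 : q ^ (t + 2) = q * q ^ (t + 1) := by ring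
    rw [e2] at h3 ⊢
    rw [e1]
    generalize q ^ (t + 1) = x at *
    generalize qPoch q q t = u at *
    generalize hd : 1 - x = d at *
    generalize he : 1 - q * x = e at *
    field_simp
    rw [← hd, ← he]
    ring
  | succ M ih =>
    have h := ih (t + 1)
    rw [Finset.sum_range_succ, show M + 1 + t = M + (t + 1) by ring, h]
    have h1 := baileyEntry_add q (M + 1) (t + 1)
    have h2 := baileyEntry_add q (M + 1) t
    rw [show M + 1 + (t + 1) = M + (t + 1) + 1 by ring,
      show t + 1 + 2 * (M + 1) + 1 = 2 * M + t + 4 by ring] at h1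
    rw [show M + 1 + t = M + (t + 1) by ring,
      show t + 2 * (M + 1) + 1 = 2 * M + t + 3 by ring] at h2
    rw [h1, h2, baileyWeight, show 2 * (M + 1) + t + 2 = 2 * M + t + 4 by ring,
      show 2 * M + (t + 1) + 2 = 2 * M + t + 3 by ring, qPoch_self_succ q (2 * M + t + 3),
      qPoch_self_succ q t]
    have k1 := one_sub_pow_succ_ne_zero hq t
    have k2 := one_sub_pow_succ_ne_zero hq (2 * M + t + 3)
    have k3 := hN t
    have k4 := hN (2 * M + t + 3)
    generalize qPoch q q t = u at *
    generalize qPoch q q (2 * M + t + 3) = v at *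
    have e1 : q ^ (2 * M + t + 3 + 1) = (q ^ M) ^ 2 * q ^ t * q ^ 4 := by ring
    have e2 : q ^ (t + 1) = q ^ t * q := by ring
    have e3 : q ^ (2 * (M + (t + 1)) + 2) = (q ^ M) ^ 2 * (q ^ t) ^ 2 * q ^ 4 := by ring
    have e4 : q ^ (M ^ 2 + M + (M + (t + 1)) + 1) = q ^ (M ^ 2) * (q ^ M) ^ 2 * q ^ t * q ^ 2 := by
      ring
    have e5 : q ^ ((M + 1) ^ 2 + 0 * ((M + 1) ^ 2 + (M + 1))) = q ^ (M ^ 2) * (q ^ M) ^ 2 * q := by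
      ring
    have e6 : q ^ ((M + 1) ^ 2 + (M + 1) + (M + (t + 1)) + 1)
      = q ^ (M ^ 2) * (q ^ M) ^ 4 * q ^ t * q ^ 4 := by ring
    have e7 : q ^ (2 * M + 2) = (q ^ M) ^ 2 * q ^ 2 := by ring
    have e8 : q ^ (2 * (M + 1) + 1) = (q ^ M) ^ 2 * q ^ 3 := by ring
    have e9 : q ^ (2 * (M + 1) + 2) = (q ^ M) ^ 2 * q ^ 4 := by ring
    rw [e1] at k2 ⊢
    rw [e2] at k1 ⊢
    rw [e3, e4, e5, e6, e7, e8, e9, pow_succ (-1 : ℂ)]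
    generalize q ^ (M ^ 2) = Z at *
    generalize q ^ M = y at *
    generalize q ^ t = x at *
    generalize (-1 : ℂ) ^ M = ε at *
    generalize hd : 1 - x * q = d at *
    generalize he : 1 - y ^ 2 * x * q ^ 4 = e at *
    field_simp
    rw [← hd, ← he]
    ring

lemma sum_baileyWeight_zero {q : ℂ} (hq : ‖q‖ < 1) (n : ℕ) :
    ∑ r ∈ Finset.range (n + 1), baileyWeight q 0 r * baileyEntry q n r
      = 1 / qPoch (q ^ 2) (q ^ 2) n := by
  induction n with
  | zero =>
    have h := one_sub_pow_succ_ne_zero hq 0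
    simp only [zero_add, pow_one] at h
    simp [baileyWeight, baileyEntry, qPoch, h]
  | succ n ih =>
    have h := sum_baileyWeight_zero_step hq n 0
    rw [Finset.sum_sub_distrib, ← Finset.mul_sum, add_zero, ih] at h
    have h1 := baileyEntry_add q (n + 1) 0
    have k1 := one_sub_pow_succ_ne_zero hq (2 * n + 1)
    have k2 := one_sub_pow_succ_ne_zero hq (2 * n + 2)
    have k3 := qPoch_self_ne_zero hq (2 * n + 2)
    rw [show 2 * n + 1 + 1 = 2 * n + 2 by ring] at k1
    rw [Finset.sum_range_succ, qPoch_succ, show q ^ 2 * (q ^ 2) ^ n = q ^ (2 * n + 2) by ring]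
    rw [add_zero, show 0 + 2 * (n + 1) + 1 = (2 * n + 2) + 1 by ring, qPoch_self_succ,
      qPoch_zero] at h1
    rw [h1, baileyWeight, show 2 * (n + 1) + 1 = 2 * n + 2 + 1 by ring]
    simp only [add_zero, qPoch_zero, zero_mul, one_mul] at h ⊢
    rw [show n ^ 2 + n + n + 1 = (n + 1) ^ 2 by ring] at h
    have k4 : qPoch (q ^ 2) (q ^ 2) n ≠ 0 := by
      have : ‖q ^ 2‖ < 1 := by rw [norm_pow]; exact pow_lt_one₀ (norm_nonneg _) hq two_ne_zero
      exact qPoch_self_ne_zero this n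
    generalize qPoch (q ^ 2) (q ^ 2) n = w at *
    generalize qPoch q q (2 * n + 2) = v at *
    generalize 1 - q ^ (2 * n + 2) = d at *
    generalize 1 - q ^ (2 * n + 2 + 1) = e at *
    generalize ∑ r ∈ Finset.range (n + 1), baileyWeight q 0 r * baileyEntry q (n + 1) r = S at *
    rw [pow_succ (-1 : ℂ)]
    field_simp at h ⊢
    linear_combination h

/-- The closed form of the inner multiple sum provided by the Bailey chain. -/
noncomputable def baileySum (q : ℂ) (d n : ℕ) : ℂ :=
  ∑ r ∈ Finset.range (n + 1), baileyWeight q d r * baileyEntry q n r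

lemma baileySum_succ {q : ℂ} (hq : ‖q‖ < 1) (d n : ℕ) :
    baileySum q (d + 1) n
      = ∑ m ∈ Finset.range (n + 1),
          q ^ (m ^ 2 + m) * invqPoch q ((n : ℤ) - m) * baileySum q d m := by
  have h : ∀ m ∈ Finset.range (n + 1), baileySum q d m
      = ∑ r ∈ Finset.range (n + 1), baileyWeight q d r * baileyEntry q m r := by
    intro m hm
    refine Finset.sum_subset (Finset.range_mono (by have := Finset.mem_range.1 hm; omega)) ?_
    intro r _ hr
    rw [baileyEntry_of_lt q (by simpa using hr), mul_zero]
  rw [Finset.sum_congr rfl fun m hm => by rw [h m hm, Finset.mul_sum], Finset.sum_comm, baileySum]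
  refine Finset.sum_congr rfl fun r _ => ?_
  calc _ = baileyWeight q d r * (q ^ (r ^ 2 + r) * baileyEntry q n r) := by
        rw [baileyWeight, baileyWeight]; ring
    _ = _ := by
        rw [← baileyEntry_step hq, Finset.mul_sum]
        exact Finset.sum_congr rfl fun m _ => by ring

/-! ### The multiple sum as an iterated Bailey chain -/

lemma partialSum_zero {d : ℕ} (v : Fin (d + 1) → ℕ) : partialSum v 0 = ∑ i, v i := by
  have : Finset.Ici (0 : Fin (d + 1)) = Finset.univ := by ext; simp
  rw [partialSum, this]

lemma partialSum_succ {d : ℕ} (v : Fin (d + 1) → ℕ) (j : Fin d) :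
    partialSum v j.succ = partialSum (Fin.tail v) j := by
  have h : ∀ (m : ℕ) (i : Fin m), Finset.Ici i = Finset.univ.filter (i ≤ ·) := by
    intros; ext; simp
  rw [partialSum, partialSum, h, h, Finset.sum_filter, Finset.sum_filter, Fin.sum_univ_succ]
  simp [Fin.tail]

lemma partialSum_zero_eq_add {d : ℕ} (v : Fin (d + 2) → ℕ) :
    partialSum v 0 = v 0 + partialSum (Fin.tail v) 0 := by
  rw [partialSum_zero, partialSum_zero, Fin.sum_univ_succ]; rfl

lemma multisumTerm_one (q : ℂ) (n : ℕ) (v : Fin 1 → ℕ) :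
    multisumTerm q n 1 v = q ^ (v 0 ^ 2 + v 0) * invqPoch q ((n : ℤ) - v 0) *
      (1 / qPoch (q ^ 2) (q ^ 2) (v 0)) := by
  simp [multisumTerm, partialSum_zero, div_eq_mul_inv]

/-- Since `n_1 = N_1 - N_2`, the factor `1/(q;q)_{n_1}` is the leading factor of the shorter
multisum with `N_1` in the role of `n`. -/
lemma multisumTerm_succ (q : ℂ) (n d : ℕ) (v : Fin (d + 2) → ℕ) :
    multisumTerm q n (d + 2) v =
      q ^ (partialSum v 0 ^ 2 + partialSum v 0) * invqPoch q ((n : ℤ) - partialSum v 0) *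
        multisumTerm q (partialSum v 0) (d + 1) (Fin.tail v) := by
  have h : invqPoch q ((partialSum v 0 : ℕ) - (partialSum (Fin.tail v) 0 : ℕ) : ℤ)
      = 1 / qPoch q q (v 0) := by
    rw [invqPoch_natCast_sub q (by rw [partialSum_zero_eq_add]; omega), partialSum_zero_eq_add,
      Nat.add_sub_cancel]
  simp only [multisumTerm]
  rw [h, Fin.sum_univ_succ, Fin.prod_univ_succ, pow_add]
  simp only [partialSum_succ]
  simp only [div_eq_mul_inv, mul_inv, Fin.tail, Fin.castSucc_zero, Fin.succ_castSucc, Fin.succ_last,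
    one_mul]
  ring

lemma multisumTerm_eq_zero (q : ℂ) {n d : ℕ} {v : Fin (d + 1) → ℕ} (h : n < partialSum v 0) :
    multisumTerm q n (d + 1) v = 0 := by
  simp [multisumTerm, invqPoch_of_lt q h]

lemma partialSum_tail_injective (d : ℕ) :
    Function.Injective fun v : Fin (d + 2) → ℕ => (partialSum v 0, Fin.tail v) := by
  intro v w h
  simp only [Prod.mk.injEq, partialSum_zero_eq_add] at h
  obtain ⟨h1, h2⟩ := h
  rw [h2] at h1
  rw [← Fin.cons_self_tail v, ← Fin.cons_self_tail w, h2, Nat.add_right_cancel h1]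

lemma hasSum_multisumTerm {q : ℂ} (hq : ‖q‖ < 1) (d n : ℕ) :
    HasSum (multisumTerm q n d) (baileySum q d n) := by
  induction d generalizing n with
  | zero =>
    have := hasSum_unique (multisumTerm q n 0)
    rwa [multisumTerm, ← sum_baileyWeight_zero hq] at this
  | succ d ih =>
    have hfin : HasSum (fun m : ℕ => q ^ (m ^ 2 + m) * invqPoch q ((n : ℤ) - m) * baileySum q d m)
        (baileySum q (d + 1) n) := by
      rw [baileySum_succ hq]
      refine hasSum_sum_of_ne_finset_zero fun m hm => ?_
      rw [invqPoch_of_lt q (by simpa using hm)]; simp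
    -- The passage from no variable to one is separate, since with no variable there is no partial
    -- sum to peel off.
    rcases d with _ | d
    · rw [← (Equiv.funUnique (Fin 1) ℕ).symm.hasSum_iff]
      refine hfin.congr_fun ?_
      intro m
      simp [multisumTerm_one, baileySum, sum_baileyWeight_zero hq]
    · set g : ℕ × (Fin (d + 1) → ℕ) → ℂ := fun p =>
        q ^ (p.1 ^ 2 + p.1) * invqPoch q ((n : ℤ) - p.1) * multisumTerm q p.1 (d + 1) p.2 with hg
      have hs : Summable g := by
        -- A nonzero term needs `N_1 ≤ n` and `N_2 ≤ N_1`, which bounds every entry by `n`.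
        refine summable_of_hasFiniteSupport (((Set.finite_Iic n).prod
          (Set.finite_Iic (fun _ : Fin (d + 1) => n))).subset ?_)
        rintro ⟨m, w⟩ hp
        by_contra hcon
        apply hp
        rcases lt_or_ge n m with h | h
        · simp [hg, invqPoch_of_lt q h]
        · have : m < partialSum w 0 := by
            by_contra hw
            refine hcon ⟨h, fun i => ?_⟩
            rw [partialSum_zero] at hw
            have := Finset.single_le_sum (f := w) (fun _ _ => Nat.zero_le _) (Finset.mem_univ i)
            simp only
            omega
          simp [hg, multisumTerm_eq_zero q this]
      have hsum : HasSum g (baileySum q (d + 1 + 1) n) := by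
        have h1 := hs.hasSum.prod_fiberwise fun m => (ih m).mul_left
          (q ^ (m ^ 2 + m) * invqPoch q ((n : ℤ) - m))
        rw [← h1.unique hfin]
        exact hs.hasSum
      -- Reindexing by `(N_1, (n_2, …))` misses only pairs with `N_1 < N_2`, where the term
      -- vanishes.
      rw [← (partialSum_tail_injective d).hasSum_iff] at hsum
      · convert hsum using 1
        ext v
        exact multisumTerm_succ q n d v
      · rintro ⟨m, w⟩ hp
        have : m < partialSum w 0 := by
          by_contra hw
          refine hp ⟨Fin.cons (m - partialSum w 0) w, ?_⟩
          simp only [partialSum_zero_eq_add, Fin.tail_cons, Fin.cons_zero, Prod.mk.injEq, and_true]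
          omega
        simp [hg, multisumTerm_eq_zero q this]

/-! ### Inserting the Bailey pair and summing over `n` -/

/-- The outer factor `(q;q)_{2n} q^n / ((a;q)_{n+1} (q/a;q)_n)`. -/
noncomputable def outerFactor (a q : ℂ) (n : ℕ) : ℂ :=
  qPoch q q (2 * n) * q ^ n / (qPoch a q (n + 1) * qPoch (q / a) q n)

/-- The product `(q, a, q/a; q)_∞`. -/
noncomputable def thetaProd (a q : ℂ) : ℂ :=
  qPochInf q q * qPochInf a q * qPochInf (q / a) q

lemma lhsTerm_eq {q : ℂ} (hq : ‖q‖ < 1) (d : ℕ) (a : ℂ) (n : ℕ) :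
    lhsTerm (d + 1) a q n = outerFactor a q n * baileySum q d n := by
  rw [lhsTerm, Nat.add_sub_cancel, (hasSum_multisumTerm hq d n).tsum_eq, outerFactor]

/-- The infinite products absorb the finite denominators into tails. Since `AB = q^{2L+2}`, the
quotient of `(q;q)_{2n}` by `(q;q)_{n+L+1}` becomes Warnaar's `(AB/q;q)_{2p} / (AB;q)_p`, up to `1 -
q^{2L+1}`. -/
lemma outerFactor_mul_baileyEntry {a q : ℂ} (hq0 : q ≠ 0) (hq : ‖q‖ < 1) (ha : a ≠ 0)
    (h1 : ∀ j : ℕ, a * q ^ j ≠ 1) (h2 : ∀ j : ℕ, q / a * q ^ j ≠ 1) (L p : ℕ) :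
    thetaProd a q * (outerFactor a q (L + p) * baileyEntry q (L + p) L)
      = q ^ L / (1 - q ^ (2 * L + 1)) *
        warnaarTerm (a * q ^ (L + 1)) (q / a * q ^ L) q p := by
  have k1 := qPoch_ne_zero h1 (L + p + 1)
  have k2 := qPoch_ne_zero h2 (L + p)
  have k3 := qPoch_self_ne_zero hq p
  have k4 := qPoch_self_ne_zero hq (p + 2 * L + 1)
  have k5 := qPoch_self_ne_zero hq (2 * L + 1)
  have k6 := one_sub_pow_succ_ne_zero hq (2 * L)
  have hc : a * q ^ (L + 1) * (q / a * q ^ L) = q * q ^ (2 * L + 1) := by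
    field_simp; ring
  have hc' : q * q ^ (2 * L + 1) / q = q * q ^ (2 * L) := by
    field_simp; ring
  have e1 : qPoch q q (2 * (L + p)) = qPoch q q (2 * L) * qPoch (q * q ^ (2 * L)) q (2 * p) := by
    rw [mul_add, qPoch_add]
  have e2 : qPoch q q (p + 2 * L + 1)
      = qPoch q q (2 * L + 1) * qPoch (q * q ^ (2 * L + 1)) q p := by
    rw [← qPoch_add]; congr 1; ring
  have e3 : qPoch q q (2 * L + 1) = qPoch q q (2 * L) * (1 - q ^ (2 * L + 1)) := qPoch_self_succ _ _
  have k7 : qPoch (q * q ^ (2 * L + 1)) q p ≠ 0 := fun h => k4 (by rw [e2, h, mul_zero])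
  have k8 := qPoch_self_ne_zero hq (2 * L)
  rw [thetaProd, outerFactor, baileyEntry_add, warnaarTerm, hc, hc', qPochInf_eq hq q p,
    qPochInf_eq hq a (L + p + 1), qPochInf_eq hq (q / a) (L + p), e1, e2, e3,
    show a * q ^ (L + 1) * q ^ p = a * q ^ (L + p + 1) by ring,
    show q / a * q ^ L * q ^ p = q / a * q ^ (L + p) by ring, pow_add q L p]
  generalize qPochInf (q * q ^ p) q = u1
  generalize qPochInf (a * q ^ (L + p + 1)) q = u2
  generalize qPochInf (q / a * (q ^ L * q ^ p)) q = u3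
  generalize 1 - q ^ (2 * L + 1) = d at *
  generalize qPoch q q p = v1 at *
  generalize qPoch q q (2 * L) = v2 at *
  generalize qPoch a q (L + p + 1) = v3 at *
  generalize qPoch (q / a) q (L + p) = v4 at *
  generalize qPoch (q * q ^ (2 * L + 1)) q p = v5 at *
  generalize qPoch (q * q ^ (2 * L)) q (2 * p) = v6 at *
  field_simp

lemma thetaProd_ne_zero {a q : ℂ} (hq : ‖q‖ < 1)
    (h1 : ∀ j : ℕ, a * q ^ j ≠ 1) (h2 : ∀ j : ℕ, q / a * q ^ j ≠ 1) : thetaProd a q ≠ 0 :=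
  mul_ne_zero (mul_ne_zero (qPochInf_ne_zero hq (mul_pow_ne_one hq hq)) (qPochInf_ne_zero hq h1))
    (qPochInf_ne_zero hq h2)

lemma hasSum_outerFactor_mul_baileyEntry {a q : ℂ} (hq0 : q ≠ 0) (hq : ‖q‖ < 1) (ha : a ≠ 0)
    (h1 : ∀ j : ℕ, a * q ^ j ≠ 1) (h2 : ∀ j : ℕ, q / a * q ^ j ≠ 1) (L : ℕ) :
    HasSum (fun n => thetaProd a q * (outerFactor a q n * baileyEntry q n L))
      (q ^ L / (1 - q ^ (2 * L + 1)) *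
        (partialTheta (a * q ^ (L + 1)) q + partialTheta (q / a * q ^ L) q - 1)) := by
  have hc : a * q ^ (L + 1) * (q / a * q ^ L) = q * q ^ (2 * L + 1) := by
    field_simp; ring
  have hc' : ‖a * q ^ (L + 1) * (q / a * q ^ L)‖ ≤ ‖q‖ := by
    rw [hc]; exact norm_mul_pow_le hq q _
  rw [← warnaarSum_eq hq0 hq hc',
    ← Function.Injective.hasSum_iff (add_right_injective L) (fun n hn => ?_)]
  · refine ((summable_warnaarTerm hq0 hq hc').hasSum.mul_left _).congr_fun fun p => ?_
    exact outerFactor_mul_baileyEntry hq0 hq ha h1 h2 L p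
  · have : n < L := by
      by_contra h
      exact hn ⟨n - L, by simp only; omega⟩
    rw [baileyEntry_of_lt q this]; simp

lemma exists_norm_outerFactor_le {a q : ℂ} (hq : ‖q‖ < 1)
    (h1 : ∀ j : ℕ, a * q ^ j ≠ 1) (h2 : ∀ j : ℕ, q / a * q ^ j ≠ 1) :
    ∃ C : ℝ, 0 ≤ C ∧ ∀ n, ‖outerFactor a q n‖ ≤ C * ‖q‖ ^ n := by
  obtain ⟨δ1, hδ1, H1⟩ := exists_le_norm_qPoch hq h1
  obtain ⟨δ2, hδ2, H2⟩ := exists_le_norm_qPoch hq h2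
  refine ⟨Real.exp (1 / (1 - ‖q‖)) / (δ1 * δ2), by positivity, fun n => ?_⟩
  have h3 : ‖qPoch q q (2 * n)‖ ≤ Real.exp (1 / (1 - ‖q‖)) := norm_qPoch_le hq hq.le _
  have h4 := H1 (n + 1)
  have h5 := H2 n
  rw [outerFactor, norm_div, norm_mul, norm_mul, norm_pow]
  calc _ ≤ Real.exp (1 / (1 - ‖q‖)) * ‖q‖ ^ n / (δ1 * δ2) := by gcongr
    _ = _ := by ring

lemma exists_norm_baileyEntry_le {q : ℂ} (hq : ‖q‖ < 1) :
    ∃ C : ℝ, 0 ≤ C ∧ ∀ n r, ‖baileyEntry q n r‖ ≤ C := by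
  obtain ⟨δ, hδ, H⟩ := exists_le_norm_qPoch hq (mul_pow_ne_one hq hq)
  refine ⟨1 / (δ * δ), by positivity, fun n r => ?_⟩
  unfold baileyEntry
  split_ifs
  · have h4 := H (n - r)
    have h5 := H (n + r + 1)
    rw [norm_div, norm_mul, norm_one]
    gcongr
  · rw [norm_zero]; positivity

lemma norm_baileyWeight_le {q : ℂ} (hq : ‖q‖ < 1) (d r : ℕ) :
    ‖baileyWeight q d r‖ ≤ 2 * ‖q‖ ^ r := by
  have h1 : ‖1 - q ^ (2 * r + 1)‖ ≤ 2 := by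
    refine (norm_sub_le _ _).trans ?_
    rw [norm_one, norm_pow]
    linarith [pow_le_one₀ (norm_nonneg q) hq.le (n := 2 * r + 1)]
  have h2 : ‖q‖ ^ (r ^ 2 + d * (r ^ 2 + r)) ≤ ‖q‖ ^ r :=
    pow_le_pow_of_le_one (norm_nonneg _) hq.le
      ((Nat.le_self_pow two_ne_zero r).trans (Nat.le_add_right _ _))
  rw [baileyWeight, norm_mul, norm_mul, norm_pow, norm_pow, norm_neg, norm_one, one_pow, one_mul,
    mul_comm]
  gcongr

/-- The summand of the double series obtained by inserting the Bailey pair. -/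
noncomputable def doubleTerm (a q : ℂ) (d : ℕ) (p : ℕ × ℕ) : ℂ :=
  outerFactor a q p.1 * (baileyWeight q d p.2 * baileyEntry q p.1 p.2)

lemma summable_doubleTerm {a q : ℂ} (hq : ‖q‖ < 1)
    (h1 : ∀ j : ℕ, a * q ^ j ≠ 1) (h2 : ∀ j : ℕ, q / a * q ^ j ≠ 1) (d : ℕ) :
    Summable (doubleTerm a q d) := by
  obtain ⟨C, hC0, hC⟩ := exists_norm_outerFactor_le hq h1 h2
  obtain ⟨D, hD0, hD⟩ := exists_norm_baileyEntry_le hq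
  have hg := summable_geometric_of_lt_one (norm_nonneg q) hq
  refine Summable.of_norm_bounded ((hg.mul_of_nonneg hg (fun _ => by positivity)
    (fun _ => by positivity)).mul_left (C * 2 * D)) fun p => ?_
  have b1 := hC p.1
  have b2 := hD p.1 p.2
  have b3 := norm_baileyWeight_le hq d p.2
  rw [doubleTerm, norm_mul, norm_mul]
  calc _ ≤ C * ‖q‖ ^ p.1 * (2 * ‖q‖ ^ p.2 * D) := by gcongr
    _ = _ := by ring

lemma hasSum_doubleTerm_row {q : ℂ} (hq : ‖q‖ < 1) (a : ℂ) (d n : ℕ) :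
    HasSum (fun L => doubleTerm a q d (n, L)) (lhsTerm (d + 1) a q n) := by
  rw [lhsTerm_eq hq, baileySum]
  have h : HasSum (fun L => baileyWeight q d L * baileyEntry q n L)
      (∑ r ∈ Finset.range (n + 1), baileyWeight q d r * baileyEntry q n r) :=
    hasSum_sum_of_ne_finset_zero fun L hL => by
      rw [baileyEntry_of_lt q (by simpa using hL), mul_zero]
  exact h.mul_left (outerFactor a q n)

lemma summable_lhsTerm {a q : ℂ} (hq : ‖q‖ < 1)
    (h1 : ∀ j : ℕ, a * q ^ j ≠ 1) (h2 : ∀ j : ℕ, q / a * q ^ j ≠ 1) (d : ℕ) :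
    Summable (lhsTerm (d + 1) a q) :=
  ((summable_doubleTerm hq h1 h2 d).hasSum.prod_fiberwise
    (hasSum_doubleTerm_row hq a d)).summable

/-- The left-hand side as a series over the index of the Bailey pair. -/
lemma hasSum_thetaProd_mul_tsum_lhsTerm {a q : ℂ} (hq0 : q ≠ 0) (hq : ‖q‖ < 1) (ha : a ≠ 0)
    (h1 : ∀ j : ℕ, a * q ^ j ≠ 1) (h2 : ∀ j : ℕ, q / a * q ^ j ≠ 1) (d : ℕ) :
    HasSum (fun L : ℕ => (-1) ^ L * q ^ ((d + 1) * (L ^ 2 + L)) *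
        (partialTheta (a * q ^ (L + 1)) q + partialTheta (q / a * q ^ L) q - 1))
      (thetaProd a q * ∑' n, lhsTerm (d + 1) a q n) := by
  have hs := summable_doubleTerm hq h1 h2 d
  have hrow := hs.hasSum.prod_fiberwise (hasSum_doubleTerm_row hq a d)
  rw [hrow.tsum_eq]
  have hs' := (((Equiv.prodComm ℕ ℕ).hasSum_iff.2 hs.hasSum).mul_left (thetaProd a q))
  refine hs'.prod_fiberwise fun L => ?_
  have h := (hasSum_outerFactor_mul_baileyEntry hq0 hq ha h1 h2 L).mul_left (baileyWeight q d L)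
  have k := one_sub_pow_succ_ne_zero hq (2 * L)
  convert h using 1
  · ext n
    simp only [Function.comp, Equiv.prodComm_apply, Prod.swap_prod_mk, doubleTerm]
    ring
  -- The factor `1 - q^{2L+1}` of the weight cancels the denominator left by Warnaar's sum.
  · rw [baileyWeight, show (d + 1) * (L ^ 2 + L) = L ^ 2 + d * (L ^ 2 + L) + L by ring, pow_add]
    field_simp

/-! ### Quasi-periodicity and the rearranged double series -/

lemma thetaProd_mul_q {x q : ℂ} (hq0 : q ≠ 0) (hq : ‖q‖ < 1) (hx : x ≠ 0) :
    x * thetaProd (x * q) q = -thetaProd x q := by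
  rw [thetaProd, thetaProd, qPochInf_succ hq x, show q / (x * q) = 1 / x by field_simp,
    qPochInf_succ hq (1 / x), show 1 / x * q = q / x by ring]
  field_simp
  ring

lemma thetaProd_mul_pow {x q : ℂ} (hq0 : q ≠ 0) (hq : ‖q‖ < 1) (hx : x ≠ 0) (n : ℕ) :
    x ^ n * q ^ n.choose 2 * thetaProd (x * q ^ n) q = (-1) ^ n * thetaProd x q := by
  induction n with
  | zero => simp
  | succ n ih =>
    have h := thetaProd_mul_q hq0 hq (mul_ne_zero hx (pow_ne_zero n hq0))
    rw [show x * q ^ n * q = x * q ^ (n + 1) by ring] at h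
    rw [Nat.choose_succ_succ' n 1, Nat.choose_one_right]
    calc _ = x ^ n * q ^ n.choose 2 * (x * q ^ n * thetaProd (x * q ^ (n + 1)) q) := by ring
      _ = -(x ^ n * q ^ n.choose 2 * thetaProd (x * q ^ n) q) := by rw [h]; ring
      _ = _ := by rw [ih]; ring

lemma two_mul_choose_add (n : ℕ) : 2 * n.choose 2 + n = n * n := by
  induction n with
  | zero => rfl
  | succ n ih =>
    rw [Nat.choose_succ_succ' n 1, Nat.choose_one_right]
    linarith

lemma choose_two_add (m n : ℕ) : (m + n).choose 2 = m.choose 2 + m * n + n.choose 2 := by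
  have h1 := two_mul_choose_add (m + n)
  have h2 := two_mul_choose_add m
  have h3 := two_mul_choose_add n
  nlinarith

lemma choose_succ_two (n : ℕ) : (n + 1).choose 2 = n.choose 2 + n := by
  rw [choose_two_add]; simp

/-- Quasi-periodicity applied `n` times from `a / q^n`; it makes the first sum on the right a series
of triple products, comparable term by term with the left side. -/
lemma thetaProd_div_pow {a q : ℂ} (hq0 : q ≠ 0) (hq : ‖q‖ < 1) (ha : a ≠ 0) (d n : ℕ) :
    (-1) ^ n * q ^ ((d + 1) * (n ^ 2 + n)) * thetaProd (a / q ^ n) q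
      = thetaProd a q * (a ^ n * q ^ ((2 * d + 1) * (n + 1).choose 2)) := by
  have h := thetaProd_mul_pow hq0 hq (div_ne_zero ha (pow_ne_zero n hq0)) n
  rw [div_mul_cancel₀ _ (pow_ne_zero n hq0)] at h
  have e : (d + 1) * (n ^ 2 + n) + n.choose 2 = (2 * d + 1) * (n + 1).choose 2 + n * n := by
    have := two_mul_choose_add n
    rw [choose_succ_two, sq, ← this]; ring
  have e' : q ^ ((d + 1) * (n ^ 2 + n)) * q ^ n.choose 2
      = q ^ ((2 * d + 1) * (n + 1).choose 2) * q ^ (n * n) := by rw [← pow_add, e, pow_add]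
  calc _ = q ^ ((d + 1) * (n ^ 2 + n)) * ((-1) ^ n * thetaProd (a / q ^ n) q) := by ring
    _ = (q ^ ((d + 1) * (n ^ 2 + n)) * q ^ n.choose 2) / q ^ (n * n) * a ^ n * thetaProd a q := by
      rw [← h, div_pow, ← pow_mul]; ring
    _ = _ := by rw [e']; field_simp

lemma hasSum_partialTheta {q : ℂ} (hq : ‖q‖ < 1) (x : ℂ) :
    HasSum (fun m : ℕ => (-x) ^ m * q ^ m.choose 2) (partialTheta x q) :=
  (summable_pow_mul_pow_choose hq (-x)).hasSum

lemma hasSum_partialTheta_tail {q : ℂ} (hq : ‖q‖ < 1) (x : ℂ) :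
    HasSum (fun m : ℕ => (-x) ^ (m + 1) * q ^ (m + 1).choose 2) (partialTheta x q - 1) := by
  have := (hasSum_nat_add_iff' 1).2 (hasSum_partialTheta hq x)
  simpa using this

/-- The coefficients of the Jacobi theta function `∑ a^j q^{j(j-1)/2}` over the integers. -/
noncomputable def thetaCoeff (a q : ℂ) : ℤ → ℂ
  | Int.ofNat j => a ^ j * q ^ j.choose 2
  | Int.negSucc j => a⁻¹ ^ (j + 1) * q ^ (j + 2).choose 2

lemma summable_thetaCoeff {q : ℂ} (hq : ‖q‖ < 1) (a : ℂ) : Summable (thetaCoeff a q) := by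
  have h1 := summable_pow_mul_pow_choose hq a
  have h2 : Summable fun j : ℕ => a⁻¹ ^ (j + 1) * q ^ (j + 2).choose 2 := by
    refine ((summable_pow_mul_pow_choose hq (a⁻¹ * q ^ 2)).mul_left (a⁻¹ * q)).congr fun j => ?_
    rw [choose_two_add j 2, Nat.choose_self]; ring
  convert Summable.int_rec h1 h2 using 1
  ext j
  cases j <;> rfl

/-- The two double series whose row and column sums are compared. -/
noncomputable def shiftedTerm (a q : ℂ) (d : ℕ) (y : ℕ → ℂ) (p : ℕ × ℕ) : ℂ :=
  (-1) ^ p.1 * q ^ ((d + 1) * (p.1 ^ 2 + p.1)) * ((-(a * y p.1)) ^ p.2 * q ^ p.2.choose 2)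

/-- The factor `q^{-nm}` grows, so terms cannot be bounded separately in `n` and `m`. Completing the
square with `j = m - n` makes the modulus a product of a function of `n` and one of `j`. -/
lemma norm_shiftedTerm_inv {a q : ℂ} (hq0 : q ≠ 0) (ha : a ≠ 0) (d n m : ℕ) :
    ‖shiftedTerm a q d (fun n => (q ^ n)⁻¹) (n, m)‖
      = ‖a ^ n * q ^ ((2 * d + 1) * (n + 1).choose 2) * thetaCoeff a q ((m : ℤ) - n)‖ := by
  have h : ‖shiftedTerm a q d (fun n => (q ^ n)⁻¹) (n, m)‖
      = ‖q ^ ((d + 1) * (n ^ 2 + n)) * (a ^ m * q ^ m.choose 2 / q ^ (n * m))‖ := by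
    simp only [shiftedTerm, norm_mul, norm_div, norm_pow, norm_neg, norm_one, one_pow, one_mul,
      norm_inv]
    rw [mul_pow, inv_pow, ← pow_mul]; ring
  rw [h]
  congr 1
  have hn := two_mul_choose_add n
  rcases lt_or_ge m n with hmn | hmn
  · obtain ⟨j, rfl⟩ := Nat.exists_eq_add_of_lt hmn
    rw [show (m : ℤ) - ((m + j + 1 : ℕ) : ℤ) = Int.negSucc j by omega]
    simp only [thetaCoeff]
    have e : (d + 1) * ((m + j + 1) ^ 2 + (m + j + 1)) + m.choose 2
        = (2 * d + 1) * (m + j + 1 + 1).choose 2 + (j + 2).choose 2 + (m + j + 1) * m := by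
      have h1 := two_mul_choose_add m
      have h2 := two_mul_choose_add j
      rw [show m + j + 1 + 1 = m + (j + 2) by ring, choose_two_add m, choose_two_add j 2,
        Nat.choose_self]
      zify at *
      linear_combination (-(d : ℤ)) * h1 - ((d : ℤ) + 1) * h2
    have e' : q ^ ((d + 1) * ((m + j + 1) ^ 2 + (m + j + 1))) * q ^ m.choose 2
        = q ^ ((2 * d + 1) * (m + j + 1 + 1).choose 2) * q ^ (j + 2).choose 2
          * q ^ ((m + j + 1) * m) := by
      rw [← pow_add, e, pow_add, pow_add]
    calc _ = q ^ ((d + 1) * ((m + j + 1) ^ 2 + (m + j + 1))) * q ^ m.choose 2 * a ^ m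
          / q ^ ((m + j + 1) * m) := by ring
      _ = _ := by
        rw [e', show a ^ (m + j + 1) = a ^ m * a ^ (j + 1) by ring, inv_pow]
        field_simp
  · obtain ⟨j, rfl⟩ := Nat.exists_eq_add_of_le hmn
    rw [show ((n + j : ℕ) : ℤ) - n = Int.ofNat j by simp]
    simp only [thetaCoeff]
    have e : (d + 1) * (n ^ 2 + n) + (n + j).choose 2
        = (2 * d + 1) * (n + 1).choose 2 + j.choose 2 + n * (n + j) := by
      rw [choose_succ_two, choose_two_add n]
      zify at *
      linear_combination (-(d : ℤ)) * hn
    have e' : q ^ ((d + 1) * (n ^ 2 + n)) * q ^ (n + j).choose 2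
        = q ^ ((2 * d + 1) * (n + 1).choose 2) * q ^ j.choose 2 * q ^ (n * (n + j)) := by
      rw [← pow_add, e, pow_add, pow_add]
    calc _ = q ^ ((d + 1) * (n ^ 2 + n)) * q ^ (n + j).choose 2 * a ^ (n + j)
          / q ^ (n * (n + j)) := by ring
      _ = _ := by
        rw [e', pow_add a]
        field_simp

lemma summable_first {q : ℂ} (hq : ‖q‖ < 1) (a : ℂ) (d : ℕ) :
    Summable fun n : ℕ => a ^ n * q ^ ((2 * d + 1) * (n + 1).choose 2) := by
  have hQ : ‖q ^ (2 * d + 1)‖ < 1 := by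
    rw [norm_pow]; exact pow_lt_one₀ (norm_nonneg _) hq (by omega)
  refine (summable_pow_mul_pow_choose hQ (a * q ^ (2 * d + 1))).congr fun n => ?_
  rw [choose_succ_two]; ring

lemma summable_shiftedTerm_inv {a q : ℂ} (hq0 : q ≠ 0) (hq : ‖q‖ < 1) (ha : a ≠ 0) (d : ℕ) :
    Summable (shiftedTerm a q d fun n => (q ^ n)⁻¹) := by
  have h := summable_mul_of_summable_norm (summable_first hq a d).norm
    (summable_thetaCoeff hq a).norm
  have hinj : Function.Injective fun p : ℕ × ℕ => ((p.1, (p.2 : ℤ) - p.1) : ℕ × ℤ) := by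
    rintro ⟨n, m⟩ ⟨n', m'⟩ h
    simp only [Prod.mk.injEq] at h ⊢
    omega
  refine Summable.of_norm_bounded (h.comp_injective hinj).norm fun p => ?_
  exact (norm_shiftedTerm_inv hq0 ha d p.1 p.2).le

lemma summable_shiftedTerm_pow {a q : ℂ} (hq : ‖q‖ < 1) (d : ℕ) :
    Summable (shiftedTerm a q d fun n => q ^ (n + 1)) := by
  have h := summable_mul_of_summable_norm (summable_geometric_of_norm_lt_one hq).norm
    (summable_pow_mul_pow_choose hq a).norm
  refine Summable.of_norm_bounded h.norm fun p => ?_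
  simp only [shiftedTerm, norm_mul, norm_pow, norm_neg, norm_one, one_pow, one_mul]
  have h1 : ‖q‖ ^ ((d + 1) * (p.1 ^ 2 + p.1)) ≤ ‖q‖ ^ p.1 :=
    pow_le_pow_of_le_one (norm_nonneg _) hq.le (by nlinarith [Nat.zero_le (d * (p.1 ^ 2 + p.1))])
  have h2 : ‖a‖ * ‖q‖ ^ (p.1 + 1) ≤ ‖a‖ :=
    mul_le_of_le_one_right (norm_nonneg _) (pow_le_one₀ (norm_nonneg _) hq.le)
  gcongr

lemma hasSum_shiftedTerm_row {q : ℂ} (hq : ‖q‖ < 1) (a : ℂ) (d : ℕ) (y : ℕ → ℂ) (n : ℕ) :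
    HasSum (fun m => shiftedTerm a q d y (n, m))
      ((-1) ^ n * q ^ ((d + 1) * (n ^ 2 + n)) * partialTheta (a * y n) q) := by
  simp only [shiftedTerm]
  exact (hasSum_partialTheta hq (a * y n)).mul_left ((-1) ^ n * q ^ ((d + 1) * (n ^ 2 + n)))

/-- Jacobi's identity to base `Q = q^{2(d+1)}` at `x = q^m`: the terms with `q^{-nm}` form the
series at `Q/x`, those with `q^{(n+1)m}` the series at `x` without its constant term, which accounts
for the `-1`. -/
lemma hasSum_shiftedTerm_column {q : ℂ} (hq0 : q ≠ 0) (hq : ‖q‖ < 1) (a : ℂ) (d m : ℕ) :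
    HasSum (fun n => shiftedTerm a q d (fun n => (q ^ n)⁻¹) (n, m)
        - shiftedTerm a q d (fun n => q ^ (n + 1)) (n, m))
      ((-a) ^ m * q ^ m.choose 2 * thetaProd (q ^ m) (q ^ (2 * (d + 1)))) := by
  set Q := q ^ (2 * (d + 1)) with hQd
  have hQ : ‖Q‖ < 1 := by
    rw [hQd, norm_pow]; exact pow_lt_one₀ (norm_nonneg _) hq (by omega)
  have h := ((hasSum_partialTheta hQ (Q / q ^ m)).add
    (hasSum_partialTheta_tail hQ (q ^ m))).mul_left ((-a) ^ m * q ^ m.choose 2)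
  rw [show partialTheta (Q / q ^ m) Q + (partialTheta (q ^ m) Q - 1)
    = thetaProd (q ^ m) Q by
      rw [thetaProd, jacobi_triple_product (pow_ne_zero _ hq0) hQ (pow_ne_zero _ hq0)]; ring] at h
  refine h.congr_fun fun n => ?_
  have hn := two_mul_choose_add n
  have e1 : Q ^ n * Q ^ n.choose 2 = q ^ ((d + 1) * (n ^ 2 + n)) := by
    rw [hQd, ← pow_add, ← pow_mul]
    congr 1
    rw [sq, ← hn]; ring
  have e2 : Q ^ (n + 1).choose 2 = q ^ ((d + 1) * (n ^ 2 + n)) := by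
    rw [← e1, choose_succ_two, pow_add, mul_comm]
  have e3 : (-(Q / q ^ m)) ^ n * Q ^ n.choose 2
      = (-1) ^ n * q ^ ((d + 1) * (n ^ 2 + n)) / q ^ (n * m) := by
    rw [← e1, neg_pow, div_pow, show q ^ (n * m) = (q ^ m) ^ n by ring]; ring
  rw [e3, e2]
  simp only [shiftedTerm]
  rw [show -(a * (q ^ n)⁻¹) = -a * (q ^ n)⁻¹ by ring,
    show -(a * q ^ (n + 1)) = -a * q ^ (n + 1) by ring,
    mul_pow, mul_pow, inv_pow, ← pow_mul, neg_pow (q ^ m)]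
  ring

/-- The difference between the left-hand side and the first sum on the right-hand side. -/
lemma hasSum_thetaProd_mul_sub {a q : ℂ} (hq0 : q ≠ 0) (hq : ‖q‖ < 1) (ha : a ≠ 0)
    (h1 : ∀ j : ℕ, a * q ^ j ≠ 1) (h2 : ∀ j : ℕ, q / a * q ^ j ≠ 1) (d : ℕ) :
    HasSum (fun m : ℕ => (-a) ^ m * q ^ m.choose 2 * thetaProd (q ^ m) (q ^ (2 * (d + 1))))
      (thetaProd a q * (∑' n : ℕ, a ^ n * q ^ ((2 * d + 1) * (n + 1).choose 2))
        - thetaProd a q * ∑' n, lhsTerm (d + 1) a q n) := by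
  have s1 := (summable_shiftedTerm_inv hq0 hq ha d).hasSum
  have s2 := (summable_shiftedTerm_pow (a := a) hq d).hasSum
  have s := s1.sub s2
  have hrow := s.prod_fiberwise fun n => (hasSum_shiftedTerm_row hq a d _ n).sub
    (hasSum_shiftedTerm_row hq a d _ n)
  have hcol := ((Equiv.prodComm ℕ ℕ).hasSum_iff.2 s).prod_fiberwise
    (hasSum_shiftedTerm_column hq0 hq a d)
  have hdiff := ((summable_first hq a d).hasSum.mul_left (thetaProd a q)).sub
    (hasSum_thetaProd_mul_tsum_lhsTerm hq0 hq ha h1 h2 d)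
  -- The contributions `θ(q^{n+1}/a) - 1` of both series cancel here.
  have e := hdiff.unique (hrow.congr_fun fun n => by
    rw [← thetaProd_div_pow hq0 hq ha, thetaProd,
      jacobi_triple_product hq0 hq (div_ne_zero ha (pow_ne_zero n hq0)),
      show q / (a / q ^ n) = q / a * q ^ n by field_simp]
    simp only [div_eq_mul_inv]
    ring)
  rw [e]
  exact hcol

/-! ### Splitting into residue classes and the final identity -/

/-- Quasi-periodicity to base `q^κ`, used `N` times; as `κ` is even, the shift by `Nκ` adds no sign
from `-a`, and `(-1)^N` comes from the theta product. -/
lemma term_residue {q : ℂ} (hq0 : q ≠ 0) (hq : ‖q‖ < 1) (a : ℂ) (d i N : ℕ) :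
    (-a) ^ (N * (2 * (d + 1)) + i) * q ^ (N * (2 * (d + 1)) + i).choose 2 *
        thetaProd (q ^ (N * (2 * (d + 1)) + i)) (q ^ (2 * (d + 1)))
      = (-1) ^ i * a ^ i * q ^ i.choose 2 * thetaProd (q ^ i) (q ^ (2 * (d + 1))) *
        ((-1) ^ N * a ^ (2 * (d + 1) * N) * q ^ ((2 * d + 1) * ((d + 1) * N + i) * N)) := by
  set Q := q ^ (2 * (d + 1)) with hQd
  have hQ : ‖Q‖ < 1 := by
    rw [hQd, norm_pow]; exact pow_lt_one₀ (norm_nonneg _) hq (by omega)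
  have hQ0 : Q ≠ 0 := pow_ne_zero _ hq0
  have h := thetaProd_mul_pow hQ0 hQ (pow_ne_zero i hq0) N
  have e1 : q ^ (N * (2 * (d + 1)) + i) = q ^ i * Q ^ N := by
    rw [hQd, ← pow_mul, ← pow_add]; congr 1; ring
  have e2 : q ^ (N * (2 * (d + 1)) + i).choose 2
      = q ^ i.choose 2 * q ^ ((2 * d + 1) * ((d + 1) * N + i) * N) *
        ((q ^ i) ^ N * Q ^ N.choose 2) := by
    rw [hQd, ← pow_mul, ← pow_mul, ← pow_add, ← pow_add, ← pow_add]
    congr 1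
    have h1 := two_mul_choose_add (N * (2 * (d + 1)) + i)
    have h2 := two_mul_choose_add i
    have h3 := two_mul_choose_add N
    zify at *
    have h4 : (2 : ℤ) * ((N * (2 * (d + 1)) + i).choose 2 : ℤ)
      = 2 * ((i.choose 2 : ℤ) + (2 * d + 1) * ((d + 1) * N + i) * N
        + (i * N + 2 * (d + 1) * (N.choose 2 : ℤ))) := by
      linear_combination h1 - h2 - 2 * ((d : ℤ) + 1) * h3
    linarith
  rw [e1, e2, show (-a) ^ (N * (2 * (d + 1)) + i) = (-1) ^ i * a ^ i * a ^ (2 * (d + 1) * N) by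
    rw [pow_add, neg_pow a i, mul_comm N, pow_mul, pow_mul (-a), neg_sq, ← pow_mul, ← pow_mul,
      ← mul_assoc]; ring]
  calc _ = (-1) ^ i * a ^ i * a ^ (2 * (d + 1) * N) * (q ^ i.choose 2 *
        q ^ ((2 * d + 1) * ((d + 1) * N + i) * N)) *
        ((q ^ i) ^ N * Q ^ N.choose 2 * thetaProd (q ^ i * Q ^ N) Q) := by ring
    _ = _ := by rw [h]; ring

lemma summable_second {q : ℂ} (hq : ‖q‖ < 1) (a : ℂ) (d i : ℕ) :
    Summable fun N : ℕ => (-1) ^ N * a ^ (2 * (d + 1) * N) *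
      q ^ ((2 * d + 1) * ((d + 1) * N + i) * N) := by
  have hQ : ‖q ^ ((2 * d + 1) * (2 * (d + 1)))‖ < 1 := by
    rw [norm_pow]; exact pow_lt_one₀ (norm_nonneg _) hq (by positivity)
  refine (summable_pow_mul_pow_choose hQ
    (-(a ^ (2 * (d + 1)) * q ^ ((2 * d + 1) * (d + 1 + i))))).congr fun N => ?_
  have e : (2 * d + 1) * ((d + 1) * N + i) * N
      = (2 * d + 1) * (d + 1 + i) * N + (2 * d + 1) * (2 * (d + 1)) * N.choose 2 := by
    have h := two_mul_choose_add N
    zify at *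
    linear_combination (-(2 * (d : ℤ) + 1) * (d + 1)) * h
  rw [e, pow_add, neg_pow, mul_pow, ← pow_mul, ← pow_mul, ← pow_mul]
  ring

lemma main_identity {a q : ℂ} (hq0 : q ≠ 0) (hq : ‖q‖ < 1) (ha : a ≠ 0)
    (h1 : ∀ j : ℕ, a * q ^ j ≠ 1) (h2 : ∀ j : ℕ, q / a * q ^ j ≠ 1) (d : ℕ) :
    ∑' n, lhsTerm (d + 1) a q n = (∑' n : ℕ, a ^ n * q ^ ((2 * d + 1) * (n + 1).choose 2))
      + ∑ i ∈ Finset.Icc 1 (2 * d + 1), tripleCoeff (2 * (d + 1)) a q i *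
        ∑' N : ℕ, (-1) ^ N * a ^ (2 * (d + 1) * N) * q ^ ((2 * d + 1) * ((d + 1) * N + i) * N) := by
  set κ := 2 * (d + 1) with hκ
  have hT := thetaProd_ne_zero hq h1 h2
  have hQ : ‖q ^ κ‖ < 1 := by
    rw [norm_pow]; exact pow_lt_one₀ (norm_nonneg _) hq (by omega)
  have hm := hasSum_thetaProd_mul_sub hq0 hq ha h1 h2 d
  rw [← hκ] at hm
  have : NeZero κ := ⟨by omega⟩
  have hm2 := (Equiv.prodComm (Fin κ) ℕ).hasSum_iff.2
    ((Nat.divModEquiv κ).symm.hasSum_iff.2 hm)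
  have hres := hm2.prod_fiberwise (g := fun i : Fin κ =>
    (-1) ^ (i : ℕ) * a ^ (i : ℕ) * q ^ (i : ℕ).choose 2 * thetaProd (q ^ (i : ℕ)) (q ^ κ) *
      ∑' N : ℕ, (-1) ^ N * a ^ (κ * N) * q ^ ((2 * d + 1) * ((d + 1) * N + i) * N))
    (fun i => ((summable_second hq a d i).hasSum.mul_left _).congr_fun fun N => by
      simpa [Nat.divModEquiv] using term_residue hq0 hq a d i N)
  have hfin := hres.unique (hasSum_fintype _)
  rw [Fin.sum_univ_eq_sum_range (fun i : ℕ =>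
    (-1) ^ i * a ^ i * q ^ i.choose 2 * thetaProd (q ^ i) (q ^ κ) *
      ∑' N : ℕ, (-1) ^ N * a ^ (κ * N) * q ^ ((2 * d + 1) * ((d + 1) * N + i) * N)) κ,
    Finset.range_eq_Ico, Finset.sum_eq_sum_Ico_succ_bot (by omega),
    show Finset.Ico (0 + 1) κ = Finset.Icc 1 (2 * d + 1) by ext; simp; omega] at hfin
  -- The class of `0` drops out because `(1; q^κ)_∞ = 0`, so the sum starts at `i = 1`.
  have hz : thetaProd (q ^ 0) (q ^ κ) = 0 := by
    rw [thetaProd, pow_zero, qPochInf_one hQ]; ring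
  rw [hz, mul_zero, zero_mul, zero_add] at hfin
  refine mul_left_cancel₀ hT ?_
  rw [mul_add, Finset.mul_sum]
  -- The difference was formed as first sum minus left side; moving it across turns `(-1)^i` into
  -- `(-1)^{i+1}`.
  have hc : ∀ i ∈ Finset.Icc 1 (2 * d + 1), thetaProd a q * (tripleCoeff κ a q i *
      ∑' N : ℕ, (-1) ^ N * a ^ (κ * N) * q ^ ((2 * d + 1) * ((d + 1) * N + i) * N))
      = -((-1) ^ i * a ^ i * q ^ i.choose 2 * thetaProd (q ^ i) (q ^ κ) *
      ∑' N : ℕ, (-1) ^ N * a ^ (κ * N) * q ^ ((2 * d + 1) * ((d + 1) * N + i) * N)) := by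
    intro i hi
    have hi' : i ≤ κ := by have := (Finset.mem_Icc.1 hi).2; omega
    have e1 : thetaProd (q ^ i) (q ^ κ)
        = qPochInf (q ^ i) (q ^ κ) * qPochInf (q ^ (κ - i)) (q ^ κ) * qPochInf (q ^ κ) (q ^ κ) := by
      rw [thetaProd, pow_sub₀ q hq0 hi', ← div_eq_mul_inv]; ring
    have e2 : tripleCoeff κ a q i = (-1) ^ (i + 1) * a ^ i * q ^ i.choose 2 *
        thetaProd (q ^ i) (q ^ κ) / thetaProd a q := by rw [e1]; rfl
    rw [e2]
    field_simp
    ring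
  rw [Finset.sum_congr rfl hc, Finset.sum_neg_distrib, ← hfin]
  ring

/-- The general argument divides by `q`. At `q = 0`, with `0^0 = 1`, only `n = 0` and `i = 1`
survive, leaving `1/(1-a) = 1 + a/(1-a)`. -/
lemma main_identity_zero {a : ℂ} (ha : a ≠ 1) (d : ℕ) :
    ∑' n, lhsTerm (d + 1) a 0 n = (∑' n : ℕ, a ^ n * 0 ^ ((2 * d + 1) * (n + 1).choose 2))
      + ∑ i ∈ Finset.Icc 1 (2 * d + 1), tripleCoeff (2 * (d + 1)) a 0 i *
        ∑' N : ℕ, (-1) ^ N * a ^ (2 * (d + 1) * N) * 0 ^ ((2 * d + 1) * ((d + 1) * N + i) * N) := by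
  have hq : ‖(0 : ℂ)‖ < 1 := by simp
  have ha' : 1 - a ≠ 0 := sub_ne_zero.2 ha.symm
  have hl : ∑' n, lhsTerm (d + 1) a 0 n = 1 / (1 - a) := by
    rw [tsum_eq_single 0]
    · rw [lhsTerm_eq hq]
      simp [outerFactor, baileySum, baileyWeight, baileyEntry, qPoch]
    · intro n hn
      rw [lhsTerm_eq hq]
      simp [outerFactor, hn]
  have hf : ∑' n : ℕ, a ^ n * 0 ^ ((2 * d + 1) * (n + 1).choose 2) = 1 := by
    rw [tsum_eq_single 0]
    · simp
    · intro n hn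
      have : (n + 1).choose 2 ≠ 0 := (Nat.choose_pos (by omega)).ne'
      simp [this]
  have hs : ∑' N : ℕ, (-1) ^ N * a ^ (2 * (d + 1) * N) * 0 ^ ((2 * d + 1) * ((d + 1) * N + 1) * N)
      = (1 : ℂ) := by
    rw [tsum_eq_single 0]
    · simp
    · intro n hn
      simp [hn]
  have ht : tripleCoeff (2 * (d + 1)) a 0 1 = a / (1 - a) := by
    have h1 : 2 * (d + 1) - 1 ≠ 0 := by omega
    have h2 : qPochInf a 0 = 1 - a := by
      rw [qPochInf_succ hq, mul_zero, qPochInf_zero_left, mul_one]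
    simp [tripleCoeff, h1, h2, qPochInf_zero_left]
  rw [hl, hf, Finset.sum_eq_single 1]
  · rw [hs, ht, mul_one, one_add_div ha', sub_add_cancel]
  · intro i hi h1
    have : i.choose 2 ≠ 0 := (Nat.choose_pos (by have := (Finset.mem_Icc.1 hi).1; omega)).ne'
    simp [tripleCoeff, this]
  · intro h
    exact absurd (Finset.mem_Icc.2 ⟨le_rfl, by omega⟩) h

end PartialTheta

theorem theoremT2 (k κ : ℕ) (hk : 1 ≤ k) (hκ : κ = 2 * k) (a q : ℂ) (hq : ‖q‖ < 1)
    (ha : a ≠ 0) (hpole : ∀ m : ℤ, a ≠ q ^ m) :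
    (∀ n : ℕ, Summable fun v : Fin (k - 1) → ℕ => PartialTheta.multisumTerm q n (k - 1) v) ∧
    (Summable fun n : ℕ => PartialTheta.lhsTerm k a q n) ∧
    (Summable fun n : ℕ => a ^ n * q ^ ((κ - 1) * (n + 1).choose 2)) ∧
    (∀ i ∈ Finset.Icc 1 (κ - 1),
      Summable fun n : ℕ => (-1) ^ n * a ^ (κ * n) * q ^ ((κ - 1) * (k * n + i) * n)) ∧
    (∑' n : ℕ, PartialTheta.lhsTerm k a q n) =
      (∑' n : ℕ, a ^ n * q ^ ((κ - 1) * (n + 1).choose 2)) +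
      ∑ i ∈ Finset.Icc 1 (κ - 1), PartialTheta.tripleCoeff κ a q i *
        ∑' n : ℕ, (-1) ^ n * a ^ (κ * n) * q ^ ((κ - 1) * (k * n + i) * n) := by
  obtain ⟨d, rfl⟩ := Nat.exists_eq_add_of_le' hk
  subst hκ
  -- The excluded `a = q^m` with `m ≤ 0` are the zeros of `(a;q)_∞`, those with `m ≥ 1` the zeros of
  -- `(q/a;q)_∞`.
  have h1 : ∀ j : ℕ, a * q ^ j ≠ 1 := fun j h =>
    hpole (-(j : ℤ)) (by rw [zpow_neg, zpow_natCast]; exact eq_inv_of_mul_eq_one_left h)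
  have h2 : ∀ j : ℕ, q / a * q ^ j ≠ 1 := fun j h =>
    hpole ((j + 1 : ℕ) : ℤ) (by
      rw [zpow_natCast, pow_succ']
      field_simp at h
      exact h.symm)
  have hκ1 : 2 * (d + 1) - 1 = 2 * d + 1 := by omega
  rw [hκ1]
  refine ⟨fun n => (PartialTheta.hasSum_multisumTerm hq _ n).summable,
    PartialTheta.summable_lhsTerm hq h1 h2 d, PartialTheta.summable_first hq a d,
    fun i _ => PartialTheta.summable_second hq a d i, ?_⟩
  rcases eq_or_ne q 0 with rfl | hq0
  · exact PartialTheta.main_identity_zero (by simpa using h1 0) d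
  · exact PartialTheta.main_identity hq0 hq ha h1 h2 d
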